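/- Let $m=(m_k)_{k\ge 0}$ be a bounded sequence of integers $m_k\ge 2$, and let $G_m=\prod_{k\ge 0}\mathbb{Z}/m_k\mathbb{Z}$ be the corresponding (bounded) Vilenkin group with normalized Haar measure $\mu$. Put $M_0=1$, $M_{k+1}=m_kM_k$, and $|t|=\sum_{k\ge 0}t_k/M_{k+1}$ for $t=(t_k)\in G_m$, $t_k\in\{0,\dots,m_k-1\}$. Write $n=\sum_k n_kM_k$ with $0\le n_k<m_k$, and let $\psi_n(x)=\prod_k \exp(2\pi i\,n_kx_k/m_k)$, $n\ge 0$, be the Vilenkin functions. For $f\in L^1(G_m)$ let $\widehat f(k)=\int_{G_m} f\,\overline{\psi_k}\,d\mu$ and $S_nf=\sum_{k=0}^{n-1}\widehat f(k)\psi_k$ (so $S_0f=0$), and for a sequence $(q_k)_{k\ge0}$ of real numbers let $$T_nf=\frac1{Q_n}\sum_{k=0}^{n-1}q_kS_kf,\qquad Q_n=\sum_{k=0}^{n-1}q_k .$$ For $1\le p<\infty$ and $\alpha>0$, $\mathrm{Lip}(\alpha,p)$ is the set of all $f\in L^p(G_m)$ with $$\omega_p(\delta,f):=\sup_{|t|<\delta}\|f(\cdot-t)-f\|_p=O(\delta^\alpha)\quad\text{as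 }\delta\to0^+ .$$ Let $(q_k)_{k\ge 0}$ be a non-negative and non-increasing sequence with $q_k\asymp(\log k)^{-\beta}$ as $k\to\infty$ for some $\beta>0$, and let $f\in \mathrm{Lip}(\alpha,p)$ for some $\alpha>0$ and $1\le p<\infty$. Then, as $n\to\infty$, $$\|T_nf-f\|_p=\begin{cases}O(n^{-\alpha}), & 0<\alpha<1,\ \beta>0,\\ O(n^{-1}\log n), & \alpha=1,\ 0<\beta<1,\\ O(n^{-1}\log n\,\log\log n), & \alpha=\beta=1,\\ O(n^{-1}(\log n)^{\beta}), & \alpha>1,\ \beta>0.\end{cases}$$ -/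

import Mathlib

open MeasureTheory ProbabilityTheory Filter Asymptotics
open scoped ENNReal Topology

noncomputable section

namespace Vilenkin

/-- The Vilenkin group `G_m`, the complete direct product of the cyclic groups `ℤ/m_kℤ`, with
componentwise addition and the product topology and product σ-algebra. -/
abbrev VilenkinGroup (m : ℕ → ℕ) : Type := (k : ℕ) → ZMod (m k)

/-- The normalized Haar measure of `G_m`: the product of the uniform probability measures on the
factors. -/
def haar (m : ℕ → ℕ) [∀ k, NeZero (m k)] : Measure (VilenkinGroup m) :=
  Measure.infinitePi fun k => uniformOn (Set.univ : Set (ZMod (m k)))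

/-- The generalized powers: `M_0 = 1` and `M_{k+1} = m_k M_k`. -/
def genPow (m : ℕ → ℕ) : ℕ → ℕ
  | 0 => 1
  | k + 1 => m k * genPow m k

/-- The `k`-th digit `n_k` of `n` in the mixed radix system, `n = ∑ n_k M_k` with
`0 ≤ n_k < m_k`. -/
def digit (m : ℕ → ℕ) (n k : ℕ) : ℕ := n / genPow m k % m k

/-- The generalized Rademacher function `r_k(x) = exp(2πi x_k / m_k)`. -/
def rademacher (m : ℕ → ℕ) (k : ℕ) (x : VilenkinGroup m) : ℂ :=
  Complex.exp (2 * Real.pi * Complex.I * ((x k).val : ℂ) / (m k : ℂ))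

/-- The Vilenkin function `ψ_n = ∏_k r_k ^ n_k`. If all `m_k ≥ 2`, then `M_k ≥ 2 ^ k`, so that
`n_k = 0` for all `k ≥ n`, and the product over `k < n` contains all non-trivial factors. -/
def psi (m : ℕ → ℕ) (n : ℕ) (x : VilenkinGroup m) : ℂ :=
  ∏ k ∈ Finset.range n, rademacher m k x ^ digit m n k

/-- The `k`-th Vilenkin–Fourier coefficient of `f`. -/
def fourierCoeff (m : ℕ → ℕ) [∀ k, NeZero (m k)] (f : VilenkinGroup m → ℂ) (k : ℕ) : ℂ :=
  ∫ x, f x * (starRingEnd ℂ) (psi m k x) ∂(haar m)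

/-- The partial sum `S_n f = ∑_{k < n} f^(k) ψ_k`. -/
def partialSum (m : ℕ → ℕ) [∀ k, NeZero (m k)] (n : ℕ) (f : VilenkinGroup m → ℂ)
    (x : VilenkinGroup m) : ℂ :=
  ∑ k ∈ Finset.range n, fourierCoeff m f k * psi m k x

/-- The sums `Q_n = ∑_{k < n} q_k`. -/
def weightSum (q : ℕ → ℝ) (n : ℕ) : ℝ := ∑ k ∈ Finset.range n, q k

/-- The `T` mean `T_n f = (1 / Q_n) ∑_{k < n} q_k S_k f`. -/
def tMean (m : ℕ → ℕ) [∀ k, NeZero (m k)] (q : ℕ → ℝ) (n : ℕ) (f : VilenkinGroup m → ℂ)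
    (x : VilenkinGroup m) : ℂ :=
  ((1 / weightSum q n : ℝ) : ℂ) * ∑ k ∈ Finset.range n, (q k : ℂ) * partialSum m k f x

/-- The usual absolute value `|x| = ∑_k x_k / M_{k+1}` on `G_m`, with `x_k ∈ {0, …, m_k - 1}`. -/
def absVal (m : ℕ → ℕ) (x : VilenkinGroup m) : ℝ :=
  ∑' k, ((x k).val : ℝ) / (genPow m (k + 1) : ℝ)

/-- The modulus of continuity `ω_p(δ, f) = sup_{|t| < δ} ‖f(· - t) - f‖_p`. -/
def modulus (m : ℕ → ℕ) [∀ k, NeZero (m k)] (p : ℝ≥0∞) (δ : ℝ) (f : VilenkinGroup m → ℂ) :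
    ℝ≥0∞ :=
  ⨆ (t : VilenkinGroup m) (_ : absVal m t < δ), eLpNorm (fun x => f (x - t) - f x) p (haar m)

/-- The Lipschitz class `Lip(α, p)`: the functions `f ∈ L^p` such that
`ω_p(δ, f) = O(δ ^ α)` as `δ → 0+`. -/
def MemLip (m : ℕ → ℕ) [∀ k, NeZero (m k)] (α : ℝ) (p : ℝ≥0∞) (f : VilenkinGroup m → ℂ) :
    Prop :=
  MemLp f p (haar m) ∧
    ∃ C : ℝ, ∀ᶠ δ in 𝓝[>] (0 : ℝ), modulus m p δ f ≤ ENNReal.ofReal (C * δ ^ α)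

/-- The approximation error `‖T_n f - f‖_p`. -/
def tError (m : ℕ → ℕ) [∀ k, NeZero (m k)] (q : ℕ → ℝ) (p : ℝ≥0∞) (f : VilenkinGroup m → ℂ)
    (n : ℕ) : ℝ :=
  (eLpNorm (fun x => tMean m q n f x - f x) p (haar m)).toReal

end Vilenkin

end

/-! Since the weights `q k` sum to `Q_n`, the error is `T_n f - f = Q_n⁻¹ ∑_{k<n} q_k (S_k f - f)`.
Individual terms cannot be estimated well, because the Dirichlet kernels are not bounded in `L¹`.
Their running sums `B_n = ∑_{k<n} (S_k f - f)` can, because the Fejér sums `∑_{k<n} D_k` have `L¹`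
norm `O(n)` on a bounded Vilenkin group (`kernelNorm_fejerSum_le`).

Let `M = M_N ≤ n ≤ M_{N+1}` and `g = S_M f - f`. For `k ≥ M` one has `S_k f - f = g - S_k g`, so
`B_n - B_M` involves only `g` and Fejér sums of `g`, and its norm is `O(n ‖g‖_p)`. The kernel `D_M`
has `L¹` norm and integral 1 and lives on the subgroup where the first `N` coordinates vanish; hence
`‖g‖_p ≤ ω_p(2/M, f) = O(M^{-α})`. Adding up the levels gives `‖B_n‖_p ≤ C ∑_{k<n} (k+1)^{-α}`
(`exists_eLpNorm_sum_partialSum_sub_le`).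

Summation by parts against the non-increasing `q` turns this into `‖T_n f - f‖_p ≤ C Q_n⁻¹ ∑_{k<n}
q_k (k+1)^{-α}`. With `Q_n ≥ n q_n` and `q_k ≍ log(k+2)^{-β}`, the four rates are the sizes of `n⁻¹
log(n+2)^β ∑_{k<n} log(k+2)^{-β} (k+1)^{-α}`. -/

/-! ### Minkowski's inequality for integrals against a kernel -/

/-- Hölder's inequality for the measure `‖K‖ dν`, followed by Tonelli. The slices need a bound only
where `K` does not vanish: this is what lets a kernel supported near 0 see only small translations.
-/
theorem MeasureTheory.eLpNorm_integral_mul_le {X Y : Type*} [MeasurableSpace X] [MeasurableSpace Y]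
    {μ : Measure X} {ν : Measure Y} [SFinite μ] [SFinite ν] {p : ℝ≥0∞} (hp : 1 ≤ p) (hp_top : p ≠ ∞)
    {H : X × Y → ℂ} (hH : AEStronglyMeasurable H (μ.prod ν)) {K : Y → ℂ} (hK : Measurable K)
    {B : ℝ≥0∞} (hB : ∀ t, K t ≠ 0 → eLpNorm (fun x => H (x, t)) p μ ≤ B) :
    eLpNorm (fun x => ∫ t, H (x, t) * K t ∂ν) p μ ≤ B * ∫⁻ t, ‖K t‖ₑ ∂ν := by
  have hp0 : p ≠ 0 := (zero_lt_one.trans_le hp).ne'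
  have hr1 : 1 ≤ p.toReal := by
    simpa using ENNReal.toReal_mono hp_top hp
  have hr0 : 0 < p.toReal := zero_lt_one.trans_le hr1
  set r := p.toReal with hr
  set ν' := ν.withDensity (fun t => ‖K t‖ₑ) with hν'
  set κ := ∫⁻ t, ‖K t‖ₑ ∂ν with hκ
  have huniv : ν' Set.univ = κ := by simp [hν', hκ]
  have hac : ν' ≪ ν := withDensity_absolutelyContinuous _ _
  have hH' : AEStronglyMeasurable H (μ.prod ν') :=
    hH.mono_ac (Measure.AbsolutelyContinuous.rfl.prod hac)
  -- Hölder on `ν'`, whose total mass is `κ`; this accounts for the factor `κ ^ (r - 1)`.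
  have hpt : ∀ᵐ x ∂μ, ‖∫ t, H (x, t) * K t ∂ν‖ₑ ^ r ≤
      κ ^ (r - 1) * ∫⁻ t, ‖H (x, t)‖ₑ ^ r ∂ν' := by
    filter_upwards [hH.prodMk_left] with x hx
    have h1 : ‖∫ t, H (x, t) * K t ∂ν‖ₑ ≤ eLpNorm (fun t => H (x, t)) 1 ν' := by
      refine (enorm_integral_le_lintegral_enorm _).trans (le_of_eq ?_)
      rw [eLpNorm_one_eq_lintegral_enorm, hν',
        lintegral_withDensity_eq_lintegral_mul₀ (by fun_prop) hx.enorm]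
      simp [enorm_mul, mul_comm]
    have h2 := eLpNorm_le_eLpNorm_mul_rpow_measure_univ hp (hx.mono_ac hac)
    have h3 := ENNReal.rpow_le_rpow (h1.trans h2) hr0.le
    refine h3.trans (le_of_eq ?_)
    rw [ENNReal.mul_rpow_of_nonneg _ _ hr0.le, ← ENNReal.rpow_mul, huniv,
      eLpNorm_eq_lintegral_rpow_enorm_toReal hp0 hp_top, ← ENNReal.rpow_mul, mul_comm]
    congr 2
    · simp only [ENNReal.toReal_one, ← hr]
      field_simp
    · rw [← hr, one_div, inv_mul_cancel₀ hr0.ne', ENNReal.rpow_one]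
  have hfub : ∫⁻ x, ∫⁻ t, ‖H (x, t)‖ₑ ^ r ∂ν' ∂μ ≤ B ^ r * κ := by
    rw [lintegral_lintegral_swap (f := fun x t => ‖H (x, t)‖ₑ ^ r) (hH'.enorm.pow_const r), hν',
      lintegral_withDensity_eq_lintegral_mul₀ (by fun_prop)]
    · rw [hκ, ← lintegral_const_mul _ (by fun_prop)]
      refine lintegral_mono fun t => ?_
      by_cases ht : K t = 0
      · simp [ht]
      · simp only [Pi.mul_apply]
        rw [mul_comm]
        gcongr
        have := ENNReal.rpow_le_rpow (hB t ht) hr0.le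
        rwa [eLpNorm_eq_lintegral_rpow_enorm_toReal hp0 hp_top, ← ENNReal.rpow_mul, ← hr, one_div,
          inv_mul_cancel₀ hr0.ne', ENNReal.rpow_one] at this
    · exact (hH.enorm.pow_const r).lintegral_prod_left'
  rw [eLpNorm_eq_lintegral_rpow_enorm_toReal hp0 hp_top, ← hr]
  calc (∫⁻ x, ‖∫ t, H (x, t) * K t ∂ν‖ₑ ^ r ∂μ) ^ (1 / r)
      ≤ (κ ^ (r - 1) * (B ^ r * κ)) ^ (1 / r) := by
        refine ENNReal.rpow_le_rpow ?_ (by positivity)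
        refine (lintegral_mono_ae hpt).trans ?_
        rw [lintegral_const_mul'' _ (hH'.enorm.pow_const r).lintegral_prod_right']
        gcongr
    _ = ((B * κ) ^ r) ^ (1 / r) := by
        congr 1
        rw [ENNReal.mul_rpow_of_nonneg _ _ hr0.le, mul_left_comm]
        congr 1
        nth_rw 2 [← ENNReal.rpow_one κ]
        rw [← ENNReal.rpow_add_of_nonneg _ _ (by linarith) zero_le_one]
        simp
    _ = B * κ := by
        rw [← ENNReal.rpow_mul, mul_one_div_cancel hr0.ne', ENNReal.rpow_one]

/-! ### Invariance of the Haar measure -/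

theorem ProbabilityTheory.map_equiv_uniformOn_univ {Ω : Type*} [Fintype Ω] [MeasurableSpace Ω]
    [DiscreteMeasurableSpace Ω] (e : Ω ≃ Ω) :
    (uniformOn (Set.univ : Set Ω)).map e = uniformOn Set.univ := by
  ext s hs
  rw [Measure.map_apply (measurable_of_countable _) hs, uniformOn_univ, uniformOn_univ]
  congr 1
  rw [Measure.count_apply (.of_discrete), Measure.count_apply (.of_discrete),
    Set.encard_preimage_of_bijective e.bijective]

namespace Vilenkin

variable (m : ℕ → ℕ) [∀ k, NeZero (m k)]

instance isProbabilityMeasure_uniformOn_zmod (k : ℕ) :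
    IsProbabilityMeasure (uniformOn (Set.univ : Set (ZMod (m k)))) :=
  isProbabilityMeasure_uniformOn Set.finite_univ Set.univ_nonempty

instance isProbabilityMeasure_haar : IsProbabilityMeasure (haar m) := by
  unfold haar; infer_instance

/-- Coordinatewise bijections preserve each uniform factor; translations and negation are both of
this form. -/
theorem map_haar_of_equiv (e : ∀ k, ZMod (m k) ≃ ZMod (m k)) :
    (haar m).map (fun x k => e k (x k)) = haar m := by
  unfold haar
  rw [Measure.infinitePi_map_pi (f := fun k => e k) _ (fun k => measurable_of_countable _)]
  simp_rw [map_equiv_uniformOn_univ]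

instance isAddLeftInvariant_haar : (haar m).IsAddLeftInvariant :=
  ⟨fun g => map_haar_of_equiv m fun k => Equiv.addLeft (g k)⟩

instance isNegInvariant_haar : (haar m).IsNegInvariant :=
  ⟨map_haar_of_equiv m fun _ => Equiv.neg _⟩

end Vilenkin

namespace Vilenkin

variable (m : ℕ → ℕ)

/-! ### Mixed radix digits -/

section Digits

theorem genPow_succ (k : ℕ) : genPow m (k + 1) = m k * genPow m k := rfl

variable {m} in
theorem genPow_dvd {k l : ℕ} (h : k ≤ l) : genPow m k ∣ genPow m l := by
  induction l, h using Nat.le_induction with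
  | base => rfl
  | succ l _ ih => exact ih.trans (Dvd.intro_left _ rfl)

theorem genPow_pos [∀ k, NeZero (m k)] (k : ℕ) : 0 < genPow m k := by
  induction k with
  | zero => simp [genPow]
  | succ k ih => exact Nat.mul_pos (NeZero.pos _) ih

variable {m} in
theorem lt_genPow (hm : ∀ k, 2 ≤ m k) (k : ℕ) : k < genPow m k := by
  induction k with
  | zero => simp [genPow]
  | succ k ih =>
    rw [genPow_succ]
    have := Nat.mul_le_mul_right (genPow m k) (hm k)
    omega

variable {m} in
theorem genPow_mono [∀ k, NeZero (m k)] {k l : ℕ} (h : k ≤ l) : genPow m k ≤ genPow m l :=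
  Nat.le_of_dvd (genPow_pos m l) (genPow_dvd h)

variable {m} in
theorem digit_eq_zero {n k : ℕ} (h : n < genPow m k) : digit m n k = 0 := by
  simp [digit, Nat.div_eq_of_lt h]

variable {m} in
theorem mul_genPow_add_lt {N j i : ℕ} (hj : j < m N) (hi : i < genPow m N) :
    j * genPow m N + i < genPow m (N + 1) := by
  rw [genPow_succ]
  have := Nat.mul_le_mul_right (genPow m N) (Nat.succ_le_of_lt hj)
  rw [Nat.succ_mul] at this
  omega

variable {m} in
theorem eq_of_digit_eq (hm : ∀ k, 2 ≤ m k) {i j : ℕ} (h : ∀ k, digit m i k = digit m j k) :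
    i = j := by
  have key : ∀ k, i % genPow m k = j % genPow m k := by
    intro k
    induction k with
    | zero => simp [genPow, Nat.mod_one]
    | succ k ih =>
      rw [genPow_succ, mul_comm, Nat.mod_mul, Nat.mod_mul, ih]
      congr 2
      exact h k
  have := key (i + j)
  have h1 := lt_genPow hm (i + j)
  rwa [Nat.mod_eq_of_lt (by omega), Nat.mod_eq_of_lt (by omega)] at this

variable [∀ k, NeZero (m k)]

variable {m} in
theorem digit_mul_add_of_lt {N k : ℕ} (h : k < N) (j i : ℕ) :
    digit m (j * genPow m N + i) k = digit m i k := by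
  obtain ⟨c, hc⟩ := genPow_dvd (m := m) (Nat.succ_le_of_lt h)
  have : j * genPow m N + i = i + (j * c * m k) * genPow m k := by
    rw [hc, Nat.succ_eq_add_one, genPow_succ]; ring
  rw [digit, this, Nat.add_mul_div_right _ _ (genPow_pos m k), Nat.add_mul_mod_self_right, digit]

variable {m} in
theorem digit_mul_add_self {N j i : ℕ} (hj : j < m N) (hi : i < genPow m N) :
    digit m (j * genPow m N + i) N = j := by
  rw [digit, add_comm, Nat.add_mul_div_right _ _ (genPow_pos m N), Nat.div_eq_of_lt hi, zero_add,
    Nat.mod_eq_of_lt hj]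

end Digits

theorem psi_zero (x : VilenkinGroup m) : psi m 0 x = 1 := by simp [psi]

variable [∀ k, NeZero (m k)]

/-! ### Vilenkin functions as an orthonormal system of characters -/

section Characters

theorem rademacher_eq (k : ℕ) (x : VilenkinGroup m) :
    rademacher m k x = ZMod.stdAddChar (x k) := by
  rw [ZMod.stdAddChar_apply, ZMod.toCircle_apply, rademacher]

theorem rademacher_add (k : ℕ) (x y : VilenkinGroup m) :
    rademacher m k (x + y) = rademacher m k x * rademacher m k y := by
  simp [rademacher_eq, AddChar.map_add_eq_mul]

theorem norm_rademacher (k : ℕ) (x : VilenkinGroup m) : ‖rademacher m k x‖ = 1 := by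
  rw [rademacher_eq, ZMod.stdAddChar_apply, Circle.norm_coe]

theorem measurable_rademacher (k : ℕ) : Measurable (rademacher m k) := by
  have : rademacher m k = (fun a : ZMod (m k) => ZMod.stdAddChar a) ∘ fun x => x k := by
    ext x; exact rademacher_eq m k x
  rw [this]
  exact (measurable_of_countable _).comp (measurable_pi_apply k)

theorem sum_rademacher_pow (k : ℕ) (x : VilenkinGroup m) :
    ∑ j ∈ Finset.range (m k), rademacher m k x ^ j = if x k = 0 then (m k : ℂ) else 0 := by
  rw [rademacher_eq]
  split_ifs with h
  · simp [h]
  · rw [geom_sum_eq]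
    · rw [← AddChar.map_nsmul_eq_pow]
      simp
    · intro h1
      apply h
      apply ZMod.injective_stdAddChar
      rw [h1, AddChar.map_zero_eq_one]

variable {m} in
theorem psi_eq_prod {n L : ℕ} (hm : ∀ k, 2 ≤ m k) (h : n < genPow m L) (x : VilenkinGroup m) :
    psi m n x = ∏ k ∈ Finset.range L, rademacher m k x ^ digit m n k := by
  have aux : ∀ {a b : ℕ}, a ≤ b → n < genPow m a →
      ∏ k ∈ Finset.range a, rademacher m k x ^ digit m n k =
        ∏ k ∈ Finset.range b, rademacher m k x ^ digit m n k := by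
    intro a b hab ha
    refine Finset.prod_subset (Finset.range_mono hab) fun k _ hk => ?_
    rw [digit_eq_zero (ha.trans_le (genPow_mono (by simpa using hk))), pow_zero]
  rcases le_total n L with hnL | hnL
  · exact aux hnL (lt_genPow hm n)
  · exact (aux hnL h).symm

theorem psi_add (n : ℕ) (x y : VilenkinGroup m) : psi m n (x + y) = psi m n x * psi m n y := by
  simp [psi, rademacher_add, mul_pow, Finset.prod_mul_distrib]

theorem norm_psi (n : ℕ) (x : VilenkinGroup m) : ‖psi m n x‖ = 1 := by
  simp [psi, norm_rademacher]

theorem psi_group_zero (n : ℕ) : psi m n 0 = 1 := by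
  simp [psi, rademacher_eq]

theorem psi_neg (n : ℕ) (x : VilenkinGroup m) : psi m n (-x) = (starRingEnd ℂ) (psi m n x) := by
  have h : psi m n (-x) * psi m n x = 1 := by
    rw [← psi_add, neg_add_cancel, psi_group_zero]
  rw [eq_inv_of_mul_eq_one_left h, Complex.inv_def, Complex.normSq_eq_norm_sq, norm_psi]
  simp

theorem measurable_psi (n : ℕ) : Measurable (psi m n) := by
  unfold psi
  have := measurable_rademacher m
  fun_prop

variable {m} in
theorem psi_mul_add (hm : ∀ k, 2 ≤ m k) {N j i : ℕ} (hj : j < m N) (hi : i < genPow m N)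
    (x : VilenkinGroup m) :
    psi m (j * genPow m N + i) x = rademacher m N x ^ j * psi m i x := by
  rw [psi_eq_prod hm (mul_genPow_add_lt hj hi), Finset.prod_range_succ, digit_mul_add_self hj hi,
    psi_eq_prod hm hi, mul_comm]
  congr 1
  refine Finset.prod_congr rfl fun k hk => ?_
  rw [digit_mul_add_of_lt (by simpa using hk)]

variable {m} in
theorem psi_congr (hm : ∀ k, 2 ≤ m k) {n N : ℕ} (hn : n < genPow m N) {x y : VilenkinGroup m}
    (h : ∀ k < N, x k = y k) : psi m n x = psi m n y := by
  rw [psi_eq_prod hm hn, psi_eq_prod hm hn]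
  refine Finset.prod_congr rfl fun k hk => ?_
  rw [rademacher_eq, rademacher_eq, h k (by simpa using hk)]

variable {m} in
-- Evaluating at a coordinate generator isolates one digit, so distinct indices are separated by
-- such a point.
theorem psi_single (hm : ∀ k, 2 ≤ m k) (n k : ℕ) :
    psi m n (Pi.single k 1) = ZMod.stdAddChar (digit m n k : ZMod (m k)) := by
  rw [psi_eq_prod (L := n + k + 1) hm ((lt_genPow hm n).trans_le (genPow_mono (by omega))),
    Finset.prod_eq_single k]
  · rw [rademacher_eq, ← AddChar.map_nsmul_eq_pow]
    simp
  · intro l _ hl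
    rw [rademacher_eq, Pi.single_eq_of_ne hl, AddChar.map_zero_eq_one, one_pow]
  · intro h
    simp at h

variable {m} in
theorem fourierCoeff_psi (hm : ∀ k, 2 ≤ m k) (i j : ℕ) :
    fourierCoeff m (psi m i) j = if i = j then 1 else 0 := by
  unfold fourierCoeff
  split_ifs with hij
  · subst hij
    have : ∀ x, psi m i x * (starRingEnd ℂ) (psi m i x) = 1 := fun x => by
      rw [Complex.mul_conj, Complex.normSq_eq_norm_sq, norm_psi]; simp
    simp [this]
  · obtain ⟨k, hk⟩ : ∃ k, digit m i k ≠ digit m j k := by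
      by_contra! h
      exact hij (eq_of_digit_eq hm h)
    set t : VilenkinGroup m := Pi.single k 1
    set h : VilenkinGroup m → ℂ := fun x => psi m i x * (starRingEnd ℂ) (psi m j x) with hh
    have hmul : ∀ x, h (t + x) = h t * h x := fun x => by
      simp only [hh, psi_add, map_mul]; ring
    -- Translation by `t` multiplies the character `h` by `h t`; as `h t ≠ 1`, invariance forces its
    -- integral to vanish.
    have hint : ∫ x, h x ∂haar m = h t * ∫ x, h x ∂haar m := by
      rw [← integral_const_mul, ← integral_add_left_eq_self h t]
      simp_rw [hmul]
    have ht : h t ≠ 1 := by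
      intro h1
      have h2 : psi m i t = psi m j t := by
        have h3 : (starRingEnd ℂ) (psi m j t) * psi m j t = 1 := by
          rw [mul_comm, Complex.mul_conj, Complex.normSq_eq_norm_sq, norm_psi]; simp
        calc psi m i t = h t * psi m j t := by rw [hh]; simp only [mul_assoc, h3, mul_one]
          _ = psi m j t := by rw [h1, one_mul]
      rw [psi_single hm, psi_single hm] at h2
      have h3 := ZMod.injective_stdAddChar h2
      rw [ZMod.natCast_eq_natCast_iff'] at h3
      simp only [digit, Nat.mod_mod] at h3 hk
      exact hk h3
    by_contra h0
    exact ht (mul_right_cancel₀ h0 (by rw [one_mul]; exact hint.symm))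

end Characters

/-! ### `L¹` bounds for Dirichlet and Fejér kernels -/

section Kernels

/-- The Dirichlet kernel `D_n = ∑_{k < n} ψ_k`. -/
noncomputable def dirichletKernel (n : ℕ) (x : VilenkinGroup m) : ℂ :=
  ∑ k ∈ Finset.range n, psi m k x

/-- The non-normalized Fejér kernel `∑_{k < n} D_k`. -/
noncomputable def fejerSum (n : ℕ) (x : VilenkinGroup m) : ℂ :=
  ∑ k ∈ Finset.range n, dirichletKernel m k x

/-- The `L¹` norm of a kernel. -/
noncomputable def kernelNorm (K : VilenkinGroup m → ℂ) : ℝ≥0∞ := ∫⁻ x, ‖K x‖ₑ ∂haar m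

theorem measurable_dirichletKernel (n : ℕ) : Measurable (dirichletKernel m n) := by
  unfold dirichletKernel
  have := measurable_psi m
  fun_prop

theorem measurable_fejerSum (n : ℕ) : Measurable (fejerSum m n) := by
  unfold fejerSum
  have := measurable_dirichletKernel m
  fun_prop

variable {m} in
theorem kernelNorm_add_le {K L : VilenkinGroup m → ℂ} (hK : Measurable K) :
    kernelNorm m (fun x => K x + L x) ≤ kernelNorm m K + kernelNorm m L := by
  unfold kernelNorm
  rw [← lintegral_add_left hK.enorm]
  exact lintegral_mono fun x => enorm_add_le _ _

variable {m} in
theorem kernelNorm_sum_le {ι : Type*} (s : Finset ι) {K : ι → VilenkinGroup m → ℂ}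
    (hK : ∀ i, Measurable (K i)) :
    kernelNorm m (fun x => ∑ i ∈ s, K i x) ≤ ∑ i ∈ s, kernelNorm m (K i) := by
  unfold kernelNorm
  rw [← lintegral_finsetSum _ fun i _ => (hK i).enorm]
  exact lintegral_mono fun x => enorm_sum_le _ _

variable {m} in
theorem kernelNorm_natCast_mul (n : ℕ) {K : VilenkinGroup m → ℂ} (hK : Measurable K) :
    kernelNorm m (fun x => (n : ℂ) * K x) = n * kernelNorm m K := by
  unfold kernelNorm
  rw [← lintegral_const_mul _ hK.enorm]
  congr with x
  rw [enorm_mul]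
  congr 1
  rw [← ofReal_norm]
  simp

theorem kernelNorm_rademacher_pow_mul (N j : ℕ) (K : VilenkinGroup m → ℂ) :
    kernelNorm m (fun x => rademacher m N x ^ j * K x) = kernelNorm m K := by
  unfold kernelNorm
  congr with x
  rw [enorm_mul, enorm_pow, ← ofReal_norm (rademacher m N x), norm_rademacher]
  simp

variable {m} in
-- Splitting off the leading digit: `ψ_{jM+k} = r_N^j ψ_k` for `k < M = M_N`. The case `i = M` is
-- allowed since only `k < i` occurs, and it supplies the whole blocks needed for induction on `j`.
theorem dirichletKernel_mul_add (hm : ∀ k, 2 ≤ m k) {N j i : ℕ} (hj : j < m N)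
    (hi : i ≤ genPow m N) (x : VilenkinGroup m) :
    dirichletKernel m (j * genPow m N + i) x =
      dirichletKernel m (j * genPow m N) x + rademacher m N x ^ j * dirichletKernel m i x := by
  rw [dirichletKernel, Finset.sum_range_add, dirichletKernel, dirichletKernel, Finset.mul_sum]
  congr 1
  refine Finset.sum_congr rfl fun k hk => ?_
  rw [psi_mul_add hm hj (by simp at hk; omega)]

variable {m} in
theorem dirichletKernel_mul (hm : ∀ k, 2 ≤ m k) {N j : ℕ} (hj : j ≤ m N) (x : VilenkinGroup m) :
    dirichletKernel m (j * genPow m N) x =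
      (∑ i ∈ Finset.range j, rademacher m N x ^ i) * dirichletKernel m (genPow m N) x := by
  induction j with
  | zero => simp [dirichletKernel]
  | succ j ih =>
    rw [Nat.succ_mul, dirichletKernel_mul_add hm hj le_rfl, ih (by omega), Finset.sum_range_succ,
      add_mul]

variable {m} in
theorem fejerSum_mul_add (hm : ∀ k, 2 ≤ m k) {N j i : ℕ} (hj : j < m N)
    (hi : i ≤ genPow m N) (x : VilenkinGroup m) :
    fejerSum m (j * genPow m N + i) x =
      fejerSum m (j * genPow m N) x +
        (i * dirichletKernel m (j * genPow m N) x + rademacher m N x ^ j * fejerSum m i x) := by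
  rw [fejerSum, Finset.sum_range_add, fejerSum, fejerSum, Finset.mul_sum]
  congr 1
  rw [Finset.sum_congr rfl fun k hk =>
    dirichletKernel_mul_add hm hj (i := k) (by simp at hk; omega) x, Finset.sum_add_distrib]
  simp

variable {m} in
theorem fejerSum_mul (hm : ∀ k, 2 ≤ m k) {N j : ℕ} (hj : j ≤ m N) (x : VilenkinGroup m) :
    fejerSum m (j * genPow m N) x =
      genPow m N * ∑ i ∈ Finset.range j, dirichletKernel m (i * genPow m N) x +
      (∑ i ∈ Finset.range j, rademacher m N x ^ i) * fejerSum m (genPow m N) x := by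
  induction j with
  | zero => simp [fejerSum]
  | succ j ih =>
    rw [Nat.succ_mul, fejerSum_mul_add hm hj le_rfl, ih (by omega), Finset.sum_range_succ,
      Finset.sum_range_succ]
    ring

variable {m} in
theorem dirichletKernel_congr (hm : ∀ k, 2 ≤ m k) {n N : ℕ} (hn : n ≤ genPow m N)
    {x y : VilenkinGroup m} (h : ∀ k < N, x k = y k) :
    dirichletKernel m n x = dirichletKernel m n y :=
  Finset.sum_congr rfl fun k hk => psi_congr hm (by simp at hk; omega) h

variable {m} in
theorem fejerSum_congr (hm : ∀ k, 2 ≤ m k) {n N : ℕ} (hn : n ≤ genPow m N)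
    {x y : VilenkinGroup m} (h : ∀ k < N, x k = y k) : fejerSum m n x = fejerSum m n y :=
  Finset.sum_congr rfl fun k hk => dirichletKernel_congr hm (by simp at hk; omega) h

variable {m} in
/-- Multiplying by `∑_j r_N^j = m_N 1_{x_N = 0}` preserves the `L¹` norm of kernels that depend
on the coordinates before `N` only. -/
theorem kernelNorm_sum_rademacher_mul {N : ℕ} {K : VilenkinGroup m → ℂ} (hK : Measurable K)
    (hinv : ∀ x y : VilenkinGroup m, (∀ k < N, x k = y k) → K x = K y) :
    kernelNorm m (fun x => (∑ j ∈ Finset.range (m N), rademacher m N x ^ j) * K x) =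
      kernelNorm m K := by
  have hmeas : Measurable fun x : VilenkinGroup m =>
      (∑ j ∈ Finset.range (m N), rademacher m N x ^ j) * K x := by
    have := measurable_rademacher m
    fun_prop
  -- Sum over the `m_N` translates in coordinate `N`: they leave `K` unchanged, and for each `x`
  -- only `a = -x N` makes the geometric sum nonzero, with value `m_N`.
  have key : (m N : ℝ≥0∞) *
      kernelNorm m (fun x => (∑ j ∈ Finset.range (m N), rademacher m N x ^ j) * K x) =
      m N * kernelNorm m K := by
    unfold kernelNorm
    calc _ = ∑ a : ZMod (m N), ∫⁻ x, ‖(∑ j ∈ Finset.range (m N),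
            rademacher m N (Pi.single N a + x) ^ j) * K (Pi.single N a + x)‖ₑ ∂haar m := by
          rw [Finset.sum_congr rfl fun a _ => lintegral_add_left_eq_self (μ := haar m) (fun x =>
            ‖(∑ j ∈ Finset.range (m N), rademacher m N x ^ j) * K x‖ₑ) (Pi.single N a)]
          simp
      _ = ∫⁻ x, ∑ a : ZMod (m N), ‖(∑ j ∈ Finset.range (m N),
            rademacher m N (Pi.single N a + x) ^ j) * K (Pi.single N a + x)‖ₑ ∂haar m := by
          rw [lintegral_finsetSum]
          intro a _
          exact (hmeas.comp (measurable_const_add _)).enorm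
      _ = ∫⁻ x, m N * ‖K x‖ₑ ∂haar m := by
          congr with x
          have hKx : ∀ a : ZMod (m N), K (Pi.single N a + x) = K x := fun a =>
            hinv _ _ fun k hk => by simp [Pi.single_eq_of_ne hk.ne]
          simp_rw [hKx, enorm_mul, ← Finset.sum_mul, sum_rademacher_pow]
          congr 1
          rw [Finset.sum_eq_single (-x N)]
          · rw [← ofReal_norm]; simp
          · intro a _ ha
            rw [if_neg, enorm_zero]
            simpa [add_eq_zero_iff_eq_neg] using ha
          · simp
      _ = _ := lintegral_const_mul _ hK.enorm
  exact (ENNReal.mul_right_inj (by simp [NeZero.ne]) (by simp)).1 key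

variable {m} in
theorem kernelNorm_dirichletKernel_genPow (hm : ∀ k, 2 ≤ m k) (N : ℕ) :
    kernelNorm m (dirichletKernel m (genPow m N)) = 1 := by
  induction N with
  | zero => simp [kernelNorm, genPow, dirichletKernel, psi_zero]
  | succ N ih =>
    rw [genPow_succ, funext (dirichletKernel_mul hm le_rfl), kernelNorm_sum_rademacher_mul
      (measurable_dirichletKernel m _) fun x y h => dirichletKernel_congr hm le_rfl h, ih]

variable {m} in
theorem kernelNorm_geom_mul_le {N : ℕ} (j : ℕ) {K : VilenkinGroup m → ℂ} (hK : Measurable K) :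
    kernelNorm m (fun x => (∑ i ∈ Finset.range j, rademacher m N x ^ i) * K x) ≤
      j * kernelNorm m K := by
  rw [funext fun x => Finset.sum_mul (Finset.range j) (fun i => rademacher m N x ^ i) (K x)]
  refine (kernelNorm_sum_le (K := fun i x => rademacher m N x ^ i * K x) _ fun i =>
    ((measurable_rademacher m N).pow_const i).mul hK).trans ?_
  rw [Finset.sum_congr rfl fun i _ => kernelNorm_rademacher_pow_mul m N i K]
  simp

variable {m} in
theorem kernelNorm_dirichletKernel_mul_le (hm : ∀ k, 2 ≤ m k) {N j : ℕ} (hj : j ≤ m N) :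
    kernelNorm m (dirichletKernel m (j * genPow m N)) ≤ j := by
  rw [funext (dirichletKernel_mul hm hj)]
  refine (kernelNorm_geom_mul_le j (measurable_dirichletKernel m _)).trans ?_
  rw [kernelNorm_dirichletKernel_genPow hm, mul_one]

variable {m} in
theorem kernelNorm_sum_dirichletKernel_le (hm : ∀ k, 2 ≤ m k) {N j A : ℕ} (hj : j ≤ m N)
    (hA : m N ≤ A) :
    kernelNorm m (fun x => (genPow m N : ℂ) *
      ∑ i ∈ Finset.range j, dirichletKernel m (i * genPow m N) x) ≤
      ((A * (j * genPow m N) : ℕ) : ℝ≥0∞) := by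
  have hmeas := measurable_dirichletKernel m
  rw [kernelNorm_natCast_mul _ (by fun_prop)]
  calc (genPow m N : ℝ≥0∞) * kernelNorm m
        (fun x => ∑ i ∈ Finset.range j, dirichletKernel m (i * genPow m N) x)
      ≤ genPow m N * ∑ i ∈ Finset.range j, (A : ℝ≥0∞) := by
        gcongr
        refine (kernelNorm_sum_le _ fun i => hmeas _).trans (Finset.sum_le_sum fun i hi => ?_)
        have hi' : i ≤ m N := by simp at hi; omega
        refine (kernelNorm_dirichletKernel_mul_le hm hi').trans ?_
        exact_mod_cast hi'.trans hA
    _ = _ := by simp; ring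

variable {m} in
theorem kernelNorm_fejerSum_genPow_le (hm : ∀ k, 2 ≤ m k) {A : ℕ} (hA : ∀ k, m k ≤ A) (N : ℕ) :
    kernelNorm m (fejerSum m (genPow m N)) ≤ ((2 * A * genPow m N : ℕ) : ℝ≥0∞) := by
  have hmeas := measurable_dirichletKernel m
  induction N with
  | zero => simp [kernelNorm, genPow, fejerSum, dirichletKernel]
  | succ N ih =>
    rw [genPow_succ, funext (fejerSum_mul hm le_rfl)]
    refine (kernelNorm_add_le (by fun_prop)).trans ?_
    rw [kernelNorm_sum_rademacher_mul (measurable_fejerSum m _)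
      fun x y h => fejerSum_congr hm le_rfl h]
    refine (add_le_add (kernelNorm_sum_dirichletKernel_le hm le_rfl (hA N)) ih).trans ?_
    rw [← Nat.cast_add]
    -- As `m_N ≥ 2`, the inherited `2 A M_N` is at most `A M_{N+1}`, so the constant `2 A`
    -- reproduces itself.
    have h := Nat.mul_le_mul_left A (Nat.mul_le_mul_right (genPow m N) (hm N))
    exact_mod_cast (by linarith : A * (m N * genPow m N) + 2 * A * genPow m N ≤
      2 * A * (m N * genPow m N))

variable {m} in
-- Induction on the number of digits. For `n = j M_N + i` the full blocks cost `3 A j M_N`, the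
-- Dirichlet term `i j ≤ A j M_N`, and the remainder `4 A i` by induction; the total is at most `4 A
-- n`, without a logarithmic loss.
theorem kernelNorm_fejerSum_le (hm : ∀ k, 2 ≤ m k) {A : ℕ} (hA : ∀ k, m k ≤ A) (n : ℕ) :
    kernelNorm m (fejerSum m n) ≤ ((4 * A * n : ℕ) : ℝ≥0∞) := by
  have hmeas := measurable_dirichletKernel m
  have hmeasF := measurable_fejerSum m
  have hmeasr := measurable_rademacher m
  suffices ∀ N n, n < genPow m N → kernelNorm m (fejerSum m n) ≤ ((4 * A * n : ℕ) : ℝ≥0∞) from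
    this n n (lt_genPow hm n)
  intro N
  induction N with
  | zero =>
    intro n hn
    obtain rfl : n = 0 := by simpa [genPow] using hn
    simp [kernelNorm, fejerSum]
  | succ N ih =>
    intro n hn
    obtain ⟨j, i, hj, hi, rfl⟩ : ∃ j i, j < m N ∧ i < genPow m N ∧ n = j * genPow m N + i :=
      ⟨n / genPow m N, n % genPow m N, Nat.div_lt_of_lt_mul (by rwa [mul_comm, ← genPow_succ]),
        Nat.mod_lt _ (genPow_pos m N), (Nat.div_add_mod' _ _).symm⟩
    have hFj : kernelNorm m (fejerSum m (j * genPow m N)) ≤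
        ((3 * A * (j * genPow m N) : ℕ) : ℝ≥0∞) := by
      rw [funext (fejerSum_mul hm hj.le)]
      refine (kernelNorm_add_le (by fun_prop)).trans ((add_le_add
        (kernelNorm_sum_dirichletKernel_le hm hj.le (hA N))
        ((kernelNorm_geom_mul_le j (hmeasF _)).trans (mul_le_mul_right
          (kernelNorm_fejerSum_genPow_le hm hA N) _))).trans (le_of_eq ?_))
      rw [← Nat.cast_mul, ← Nat.cast_add]
      congr 1
      ring
    rw [funext (fejerSum_mul_add hm hj hi.le)]
    refine (kernelNorm_add_le (hmeasF _)).trans ((add_le_add hFj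
      (kernelNorm_add_le (by fun_prop))).trans ?_)
    rw [kernelNorm_rademacher_pow_mul, kernelNorm_natCast_mul _ (hmeas _)]
    refine (add_le_add_right (add_le_add (mul_le_mul_right
      (kernelNorm_dirichletKernel_mul_le hm hj.le) _) (ih i hi)) _).trans ?_
    rw [← Nat.cast_mul, ← Nat.cast_add, ← Nat.cast_add]
    have h1 : 1 ≤ A := (by norm_num : 1 ≤ 2).trans ((hm 0).trans (hA 0))
    have h2 := Nat.mul_le_mul h1 (Nat.mul_le_mul_left j hi.le)
    exact_mod_cast (by linarith : 3 * A * (j * genPow m N) + (i * j + 4 * A * i) ≤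
      4 * A * (j * genPow m N + i))

end Kernels

end Vilenkin

/-! ### Summation by parts -/

theorem Finset.sum_range_smul_eq_by_parts {R F : Type*} [CommRing R] [AddCommGroup F] [Module R F]
    (q : ℕ → R) (v : ℕ → F) (n : ℕ) :
    ∑ k ∈ Finset.range n, q k • v k = q n • ∑ k ∈ Finset.range n, v k +
      ∑ k ∈ Finset.range n, (q k - q (k + 1)) • ∑ l ∈ Finset.range (k + 1), v l := by
  induction n with
  | zero => simp
  | succ n ih =>
    rw [Finset.sum_range_succ (fun k => q k • v k), ih,
      Finset.sum_range_succ (fun k => (q k - q (k + 1)) • ∑ l ∈ Finset.range (k + 1), v l),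
      Finset.sum_range_succ v n]
    module

/-- Summation by parts against a non-increasing non-negative weight. -/
theorem MeasureTheory.eLpNorm_sum_smul_le_of_antitone {X E : Type*} [MeasurableSpace X]
    [NormedAddCommGroup E] [NormedSpace ℝ E] {μ : Measure X} {p : ℝ≥0∞} (hp : 1 ≤ p)
    {q w : ℕ → ℝ} (hq : Antitone q) (hq0 : ∀ k, 0 ≤ q k) (hw : ∀ k, 0 ≤ w k) {C : ℝ} (hC : 0 ≤ C)
    {b : ℕ → X → E} (hb : ∀ k, AEStronglyMeasurable (b k) μ)
    (hbw : ∀ n, eLpNorm (∑ k ∈ Finset.range n, b k) p μ ≤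
      ENNReal.ofReal (C * ∑ k ∈ Finset.range n, w k)) (n : ℕ) :
    eLpNorm (∑ k ∈ Finset.range n, q k • b k) p μ ≤
      ENNReal.ofReal (C * ∑ k ∈ Finset.range n, q k * w k) := by
  have parts' : ∀ n : ℕ, ∑ k ∈ Finset.range n, q k * w k = q n * ∑ k ∈ Finset.range n, w k +
      ∑ k ∈ Finset.range n, (q k - q (k + 1)) * ∑ l ∈ Finset.range (k + 1), w l := fun n => by
    simpa only [smul_eq_mul] using Finset.sum_range_smul_eq_by_parts q w n
  have hS : ∀ n, AEStronglyMeasurable (∑ k ∈ Finset.range n, b k) μ := fun n =>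
    Finset.aestronglyMeasurable_sum _ fun k _ => hb k
  have hsmul : ∀ (c : ℝ) (n : ℕ), 0 ≤ c → eLpNorm (c • ∑ k ∈ Finset.range n, b k) p μ ≤
      ENNReal.ofReal (C * (c * ∑ k ∈ Finset.range n, w k)) := by
    intro c n hc
    rw [eLpNorm_const_smul, Real.enorm_of_nonneg hc, mul_left_comm, ENNReal.ofReal_mul hc]
    gcongr
    exact hbw n
  have hW : ∀ n, 0 ≤ ∑ k ∈ Finset.range n, w k := fun n => Finset.sum_nonneg fun k _ => hw k
  have hd : ∀ k, 0 ≤ q k - q (k + 1) := fun k => sub_nonneg.2 (hq (Nat.le_succ k))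
  -- All coefficients in the Abel transform are non-negative, so bounding it termwise yields exactly
  -- the transform of `∑ q k * w k`.
  rw [Finset.sum_range_smul_eq_by_parts q b n, parts' n, mul_add, ENNReal.ofReal_add
    (mul_nonneg hC (mul_nonneg (hq0 n) (hW n))) (mul_nonneg hC (Finset.sum_nonneg fun k _ =>
      mul_nonneg (hd k) (hW _))), Finset.mul_sum (Finset.range n) _ C,
    ENNReal.ofReal_sum_of_nonneg fun k _ => mul_nonneg hC (mul_nonneg (hd k) (hW _))]
  refine (eLpNorm_add_le ((hS n).const_smul _) (Finset.aestronglyMeasurable_sum _ fun k _ =>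
    (hS _).const_smul _) hp).trans (add_le_add (hsmul _ _ (hq0 n)) ?_)
  refine (eLpNorm_sum_le (fun k _ => (hS _).const_smul _) hp).trans ?_
  exact Finset.sum_le_sum fun k _ => hsmul _ _ (hd k)

namespace Vilenkin

variable {m : ℕ → ℕ}

theorem exists_genPow_le_lt (hm : ∀ k, 2 ≤ m k) {n : ℕ} (hn : 0 < n) :
    ∃ N, genPow m N ≤ n ∧ n < genPow m (N + 1) := by
  have hex : ∃ N, n < genPow m N := ⟨n, lt_genPow hm n⟩
  obtain ⟨N, hN⟩ : ∃ N, Nat.find hex = N + 1 := by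
    refine Nat.exists_eq_succ_of_ne_zero fun h => ?_
    have := Nat.find_spec hex
    rw [h] at this
    simp [genPow] at this
    omega
  refine ⟨N, not_lt.1 (Nat.find_min hex (m := N) (by omega)), ?_⟩
  rw [← hN]
  exact Nat.find_spec hex

variable [∀ k, NeZero (m k)]

/-! ### Partial sums as convolutions, and approximation by `S_{M_N}` -/

section PartialSums

theorem integrable_mul_of_bound {g K : VilenkinGroup m → ℂ} (hg : Integrable g (haar m))
    (hK : Measurable K) {c : ℝ} (hc : ∀ x, ‖K x‖ ≤ c) :
    Integrable (fun x => g x * K x) (haar m) :=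
  hg.mul_bdd hK.aestronglyMeasurable (ae_of_all _ hc)

theorem norm_dirichletKernel_le (n : ℕ) (x : VilenkinGroup m) :
    ‖dirichletKernel m n x‖ ≤ n :=
  (norm_sum_le _ _).trans (by simp [norm_psi])

theorem integrable_comp_sub_mul_dirichletKernel {g : VilenkinGroup m → ℂ}
    (hg : Integrable g (haar m)) (n : ℕ) (x : VilenkinGroup m) :
    Integrable (fun t => g (x - t) * dirichletKernel m n t) (haar m) :=
  integrable_mul_of_bound (hg.comp_sub_left x) (measurable_dirichletKernel m n)
    (norm_dirichletKernel_le n)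

theorem integrable_mul_conj_psi {g : VilenkinGroup m → ℂ} (hg : Integrable g (haar m)) (n : ℕ) :
    Integrable (fun x => g x * (starRingEnd ℂ) (psi m n x)) (haar m) :=
  integrable_mul_of_bound hg (Complex.continuous_conj.measurable.comp (measurable_psi m n))
    (c := 1) fun x => by simp [norm_psi]

theorem partialSum_eq_integral {g : VilenkinGroup m → ℂ} (hg : Integrable g (haar m)) (n : ℕ)
    (x : VilenkinGroup m) :
    partialSum m n g x = ∫ t, g (x - t) * dirichletKernel m n t ∂haar m := by
  rw [← integral_sub_left_eq_self (fun t => g (x - t) * dirichletKernel m n t) (haar m) x]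
  simp only [sub_sub_cancel, dirichletKernel, Finset.mul_sum]
  have h : ∀ k t, g t * psi m k (x - t) =
      (g t * (starRingEnd ℂ) (psi m k t)) * psi m k x := fun k t => by
    rw [sub_eq_add_neg, psi_add, psi_neg]; ring
  simp_rw [h]
  rw [integral_finsetSum _ fun k _ => (integrable_mul_conj_psi hg k).mul_const _]
  simp_rw [integral_mul_const]
  rfl

theorem sum_partialSum_eq_integral {g : VilenkinGroup m → ℂ} (hg : Integrable g (haar m)) (n : ℕ)
    (x : VilenkinGroup m) :
    ∑ k ∈ Finset.range n, partialSum m k g x = ∫ t, g (x - t) * fejerSum m n t ∂haar m := by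
  simp only [fejerSum, Finset.mul_sum]
  rw [integral_finsetSum _ fun k _ => integrable_comp_sub_mul_dirichletKernel hg k x]
  simp_rw [partialSum_eq_integral hg]

theorem aestronglyMeasurable_comp_sub {g : VilenkinGroup m → ℂ}
    (hg : AEStronglyMeasurable g (haar m)) :
    AEStronglyMeasurable (fun z : VilenkinGroup m × VilenkinGroup m => g (z.1 - z.2))
      ((haar m).prod (haar m)) :=
  hg.comp_quasiMeasurePreserving (quasiMeasurePreserving_sub_of_right_invariant _ _)

theorem eLpNorm_sum_partialSum_le (hm : ∀ k, 2 ≤ m k) {A : ℕ} (hA : ∀ k, m k ≤ A) {p : ℝ≥0∞}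
    (hp : 1 ≤ p) (hp_top : p ≠ ∞) {g : VilenkinGroup m → ℂ} (hg : MemLp g p (haar m)) (n : ℕ) :
    eLpNorm (fun x => ∑ k ∈ Finset.range n, partialSum m k g x) p (haar m) ≤
      eLpNorm g p (haar m) * ((4 * A * n : ℕ) : ℝ≥0∞) := by
  rw [funext (sum_partialSum_eq_integral (hg.integrable hp) n)]
  refine (eLpNorm_integral_mul_le hp hp_top (aestronglyMeasurable_comp_sub hg.1)
    (measurable_fejerSum m n) (B := eLpNorm g p (haar m)) fun t _ => ?_).trans
    (mul_le_mul_right (kernelNorm_fejerSum_le hm hA n) _)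
  exact (eLpNorm_comp_measurePreserving hg.1 (measurePreserving_sub_right (haar m) t)).le

theorem memLp_psi (n : ℕ) (p : ℝ≥0∞) : MemLp (psi m n) p (haar m) :=
  MemLp.of_bound (measurable_psi m n).aestronglyMeasurable 1
    (ae_of_all _ fun x => (norm_psi m n x).le)

theorem memLp_partialSum (n : ℕ) (g : VilenkinGroup m → ℂ) (p : ℝ≥0∞) :
    MemLp (partialSum m n g) p (haar m) :=
  memLp_finsetSum (Finset.range n) fun k _ => (memLp_psi k p).const_mul (fourierCoeff m g k)

theorem fourierCoeff_partialSum (hm : ∀ k, 2 ≤ m k) (n : ℕ) (g : VilenkinGroup m → ℂ) (j : ℕ) :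
    fourierCoeff m (partialSum m n g) j = if j < n then fourierCoeff m g j else 0 := by
  have h : ∀ x, partialSum m n g x * (starRingEnd ℂ) (psi m j x) =
      ∑ k ∈ Finset.range n, fourierCoeff m g k * (psi m k x * (starRingEnd ℂ) (psi m j x)) :=
    fun x => by simp only [partialSum, Finset.sum_mul, mul_assoc]
  rw [fourierCoeff]
  simp_rw [h]
  rw [integral_finsetSum _ fun k _ => (integrable_mul_conj_psi
    ((memLp_psi k 1).integrable le_rfl) j).const_mul _]
  simp_rw [integral_const_mul]
  calc _ = ∑ k ∈ Finset.range n, fourierCoeff m g k * fourierCoeff m (psi m k) j := rfl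
    _ = _ := by simp [fourierCoeff_psi hm]

theorem partialSum_sub {g h : VilenkinGroup m → ℂ} (hg : Integrable g (haar m))
    (hh : Integrable h (haar m)) (n : ℕ) (x : VilenkinGroup m) :
    partialSum m n (fun y => g y - h y) x = partialSum m n g x - partialSum m n h x := by
  have : ∀ k, fourierCoeff m (fun y => g y - h y) k = fourierCoeff m g k - fourierCoeff m h k := by
    intro k
    simp only [fourierCoeff, sub_mul]
    exact integral_sub (integrable_mul_conj_psi hg k) (integrable_mul_conj_psi hh k)
  simp [partialSum, this, sub_mul]

theorem partialSum_partialSum (hm : ∀ k, 2 ≤ m k) {n k : ℕ} (h : n ≤ k) (g : VilenkinGroup m → ℂ)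
    (x : VilenkinGroup m) : partialSum m k (partialSum m n g) x = partialSum m n g x := by
  unfold partialSum
  rw [← Finset.sum_subset (Finset.range_mono h)]
  · refine Finset.sum_congr rfl fun j hj => ?_
    have := fourierCoeff_partialSum hm n g j
    rw [if_pos (by simpa using hj)] at this
    exact congrArg (· * psi m j x) this
  · intro j _ hj
    have := fourierCoeff_partialSum hm n g j
    rw [if_neg (by simpa using hj)] at this
    exact mul_eq_zero_of_left this _

theorem integral_dirichletKernel (hm : ∀ k, 2 ≤ m k) {n : ℕ} (hn : 0 < n) :
    ∫ x, dirichletKernel m n x ∂haar m = 1 := by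
  unfold dirichletKernel
  rw [integral_finsetSum _ fun k _ => (memLp_psi k 1).integrable le_rfl]
  have h : ∀ k, ∫ x, psi m k x ∂haar m = if k = 0 then 1 else 0 := fun k => by
    rw [← fourierCoeff_psi hm k 0]
    simp [fourierCoeff, psi_zero]
  simp [h, hn]

/-- Passing from `M_N` to `M_{N+1}` multiplies the kernel by a full geometric sum of `r_N`, which
vanishes unless `x N = 0`. -/
theorem eq_zero_of_dirichletKernel_ne_zero (hm : ∀ k, 2 ≤ m k) {N : ℕ} {x : VilenkinGroup m}
    (h : dirichletKernel m (genPow m N) x ≠ 0) : ∀ k < N, x k = 0 := by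
  induction N with
  | zero => simp
  | succ N ih =>
    rw [genPow_succ, dirichletKernel_mul hm le_rfl, sum_rademacher_pow] at h
    intro k hk
    rcases Nat.lt_succ_iff_lt_or_eq.1 hk with hk | rfl
    · exact ih (right_ne_zero_of_mul h) k hk
    · by_contra hx
      simp [hx] at h

/-- Since `x_k ≤ m_k - 1`, the `k`-th term is at most `1/M_k - 1/M_{k+1}`, and these telescope from
`N` on. -/
theorem absVal_le {N : ℕ} {x : VilenkinGroup m} (h : ∀ k < N, x k = 0) :
    absVal m x ≤ 1 / genPow m N := by
  have hterm : ∀ k, 0 ≤ ((x k).val : ℝ) / (genPow m (k + 1) : ℝ) := fun k => by positivity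
  have hsum : ∀ n, ∑ k ∈ Finset.range (N + n), ((x k).val : ℝ) / (genPow m (k + 1) : ℝ) ≤
      1 / genPow m N - 1 / genPow m (N + n) := by
    intro n
    induction n with
    | zero =>
      rw [add_zero, sub_self, Finset.sum_eq_zero]
      intro k hk
      simp [h k (by simpa using hk)]
    | succ n ih =>
      rw [← add_assoc, Finset.sum_range_succ, genPow_succ, Nat.cast_mul]
      have h1 : ((x (N + n)).val : ℝ) + 1 ≤ m (N + n) := by
        exact_mod_cast ZMod.val_lt (x (N + n))
      have h2 : (0 : ℝ) < genPow m (N + n) := by exact_mod_cast genPow_pos m (N + n)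
      have h3 : (0 : ℝ) < m (N + n) := by exact_mod_cast NeZero.pos (m (N + n))
      have h4 : ((x (N + n)).val : ℝ) / (m (N + n) * genPow m (N + n)) ≤
          1 / genPow m (N + n) - 1 / (m (N + n) * genPow m (N + n)) := by
        rw [div_sub_div _ _ h2.ne' (by positivity), div_le_div_iff₀ (by positivity) (by positivity)]
        have := mul_le_mul_of_nonneg_right h1
          (by positivity : (0 : ℝ) ≤ m (N + n) * genPow m (N + n) ^ 2)
        linarith
      linarith
  refine Real.tsum_le_of_sum_range_le hterm fun n => ?_
  refine (Finset.sum_le_sum_of_subset_of_nonneg (Finset.range_mono (Nat.le_add_left n N))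
    fun k _ _ => hterm k).trans ((hsum n).trans ?_)
  exact sub_le_self _ (by positivity)

/-- `S_M f - f` is an average of `f(· - t) - f` against `D_M`, which has integral and `L¹` norm 1.
The support gives only `|t| ≤ 1/M`, while the modulus asks for strict inequality; hence the 2. -/
theorem eLpNorm_partialSum_genPow_sub_le (hm : ∀ k, 2 ≤ m k) {p : ℝ≥0∞} (hp : 1 ≤ p)
    (hp_top : p ≠ ∞) {f : VilenkinGroup m → ℂ} (hf : MemLp f p (haar m)) (N : ℕ) :
    eLpNorm (fun x => partialSum m (genPow m N) f x - f x) p (haar m) ≤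
      modulus m p (2 / genPow m N) f := by
  have hMpos : (0 : ℝ) < genPow m N := by exact_mod_cast genPow_pos m N
  have hfi := hf.integrable hp
  have h : ∀ x, partialSum m (genPow m N) f x - f x =
      ∫ t, (f (x - t) - f x) * dirichletKernel m (genPow m N) t ∂haar m := by
    intro x
    simp_rw [sub_mul]
    rw [integral_sub (integrable_comp_sub_mul_dirichletKernel hfi _ x)
      (integrable_mul_of_bound (integrable_const _) (measurable_dirichletKernel m _)
        (norm_dirichletKernel_le _)), ← partialSum_eq_integral hfi, integral_const_mul,
      integral_dirichletKernel hm (genPow_pos m N), mul_one]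
  rw [funext h]
  have hmeas : AEStronglyMeasurable (fun z : VilenkinGroup m × VilenkinGroup m =>
      f (z.1 - z.2) - f z.1) ((haar m).prod (haar m)) :=
    (aestronglyMeasurable_comp_sub hf.1).sub hf.1.comp_fst
  refine (eLpNorm_integral_mul_le hp hp_top hmeas (measurable_dirichletKernel m _)
    (B := modulus m p (2 / genPow m N) f) fun t ht => ?_).trans ?_
  · refine le_iSup₂_of_le t ((absVal_le (eq_zero_of_dirichletKernel_ne_zero hm ht)).trans_lt ?_)
      le_rfl
    gcongr
    norm_num
  · have := kernelNorm_dirichletKernel_genPow hm N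
    rw [kernelNorm] at this
    rw [this, mul_one]

theorem exists_eLpNorm_partialSum_genPow_sub_le (hm : ∀ k, 2 ≤ m k) {p : ℝ≥0∞} (hp : 1 ≤ p)
    (hp_top : p ≠ ∞) {α : ℝ} {f : VilenkinGroup m → ℂ} (hf : MemLip m α p f) :
    ∃ C : ℝ, 0 ≤ C ∧ ∀ N, eLpNorm (fun x => partialSum m (genPow m N) f x - f x) p (haar m) ≤
      ENNReal.ofReal (C * (genPow m N : ℝ) ^ (-α)) := by
  obtain ⟨hfp, C, hC⟩ := hf
  have hMpos : ∀ N, (0 : ℝ) < genPow m N := fun N => by exact_mod_cast genPow_pos m N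
  have hfin : ∀ N, eLpNorm (fun x => partialSum m (genPow m N) f x - f x) p (haar m) ≠ ∞ :=
    fun N => ((memLp_partialSum _ f p).sub hfp).eLpNorm_ne_top
  have hM : Tendsto (fun N => (genPow m N : ℝ)) atTop atTop :=
    tendsto_natCast_atTop_atTop.comp
      (tendsto_atTop_mono (fun N => (lt_genPow hm N).le) tendsto_id)
  have hδ : Tendsto (fun N => 2 / (genPow m N : ℝ)) atTop (𝓝[>] 0) :=
    tendsto_nhdsWithin_iff.2 ⟨hM.const_div_atTop 2, .of_forall fun N => div_pos two_pos (hMpos N)⟩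
  have hO : (fun N => (eLpNorm (fun x => partialSum m (genPow m N) f x - f x) p
      (haar m)).toReal) =O[atTop] fun N => (genPow m N : ℝ) ^ (-α) := by
    refine IsBigO.of_bound (|C| * 2 ^ α) ?_
    filter_upwards [hδ.eventually hC] with N hN
    have h1 := (eLpNorm_partialSum_genPow_sub_le hm hp hp_top hfp N).trans hN
    have h2 : C * (2 / (genPow m N : ℝ)) ^ α ≤ |C| * 2 ^ α * (genPow m N : ℝ) ^ (-α) := by
      rw [Real.div_rpow two_pos.le (hMpos N).le, Real.rpow_neg (hMpos N).le, ← div_eq_mul_inv,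
        mul_div_assoc]
      gcongr
      exact le_abs_self C
    rw [Real.norm_of_nonneg ENNReal.toReal_nonneg,
      Real.norm_of_nonneg (Real.rpow_nonneg (hMpos N).le _)]
    refine ENNReal.toReal_le_of_le_ofReal ?_ (h1.trans (ENNReal.ofReal_le_ofReal h2))
    have := Real.rpow_nonneg (hMpos N).le (-α)
    positivity
  -- The comparison function never vanishes, so the finitely many exceptional `N` are absorbed into
  -- the constant.
  obtain ⟨c, hc0, hc⟩ := bound_of_isBigO_nat_atTop hO
  refine ⟨c, hc0.le, fun N => ?_⟩
  have h := hc (x := N) (Real.rpow_pos_of_pos (hMpos N) _).ne'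
  rw [Real.norm_of_nonneg ENNReal.toReal_nonneg,
    Real.norm_of_nonneg (Real.rpow_nonneg (hMpos N).le _)] at h
  exact (ENNReal.le_ofReal_iff_toReal_le (hfin N) (by
    have := Real.rpow_nonneg (hMpos N).le (-α)
    positivity)).2 h

end PartialSums

/-! ### Growth of the summed errors `∑_{k<n} (S_k f - f)` -/

section FejerError

theorem sum_Ico_partialSum_sub (hm : ∀ k, 2 ≤ m k) {f : VilenkinGroup m → ℂ}
    (hf : Integrable f (haar m)) {M n : ℕ} (h : M ≤ n) (x : VilenkinGroup m) :
    ∑ k ∈ Finset.range n, (partialSum m k f x - f x) =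
      ∑ k ∈ Finset.range M, (partialSum m k f x - f x) -
      (∑ k ∈ Finset.range n, partialSum m k (fun y => partialSum m M f y - f y) x -
        ∑ k ∈ Finset.range M, partialSum m k (fun y => partialSum m M f y - f y) x -
        ((n - M : ℕ) : ℂ) * (partialSum m M f x - f x)) := by
  have hS := (memLp_partialSum (m := m) M f 1).integrable le_rfl
  obtain ⟨d, rfl⟩ := Nat.exists_eq_add_of_le h
  rw [Finset.sum_range_add, Finset.sum_range_add]
  have : ∀ k, partialSum m (M + k) (fun y => partialSum m M f y - f y) x =
      partialSum m M f x - partialSum m (M + k) f x := fun k => by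
    rw [partialSum_sub hS hf, partialSum_partialSum hm (Nat.le_add_right M k)]
  simp only [this, Finset.sum_sub_distrib, Finset.sum_const, Finset.card_range, nsmul_eq_mul,
    Nat.add_sub_cancel_left]
  ring

theorem memLp_sum_partialSum_sub {p : ℝ≥0∞} {f : VilenkinGroup m → ℂ} (hf : MemLp f p (haar m))
    (n : ℕ) : MemLp (fun x => ∑ k ∈ Finset.range n, (partialSum m k f x - f x)) p (haar m) :=
  memLp_finsetSum _ fun k _ => (memLp_partialSum k f p).sub hf

theorem eLpNorm_sum_partialSum_sub_le_add (hm : ∀ k, 2 ≤ m k) {A : ℕ} (hA : ∀ k, m k ≤ A)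
    {p : ℝ≥0∞} (hp : 1 ≤ p) (hp_top : p ≠ ∞) {f : VilenkinGroup m → ℂ} (hf : MemLp f p (haar m))
    {M n : ℕ} (h : M ≤ n) :
    eLpNorm (fun x => ∑ k ∈ Finset.range n, (partialSum m k f x - f x)) p (haar m) ≤
      eLpNorm (fun x => ∑ k ∈ Finset.range M, (partialSum m k f x - f x)) p (haar m) +
      ((9 * A * n : ℕ) : ℝ≥0∞) *
        eLpNorm (fun x => partialSum m M f x - f x) p (haar m) := by
  set g : VilenkinGroup m → ℂ := fun x => partialSum m M f x - f x with hg
  have hgL : MemLp g p (haar m) := (memLp_partialSum M f p).sub hf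
  have hmem : ∀ n, MemLp (fun x => ∑ k ∈ Finset.range n, partialSum m k g x) p (haar m) :=
    fun n => memLp_finsetSum _ fun k _ => memLp_partialSum k g p
  rw [funext (sum_Ico_partialSum_sub hm (hf.integrable hp) h)]
  have h3 : MemLp (fun x => ((n - M : ℕ) : ℂ) * g x) p (haar m) := hgL.const_mul _
  have h4 : eLpNorm (fun x => ((n - M : ℕ) : ℂ) * g x) p (haar m) ≤
      ((n : ℕ) : ℝ≥0∞) * eLpNorm g p (haar m) := by
    rw [show (fun x => ((n - M : ℕ) : ℂ) * g x) = ((n - M : ℕ) : ℂ) • g from rfl,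
      eLpNorm_const_smul]
    gcongr
    rw [← ofReal_norm]
    simp
  refine (eLpNorm_sub_le (memLp_sum_partialSum_sub hf M).1
    (((hmem n).sub (hmem M)).sub h3).1 hp).trans ?_
  gcongr
  refine (eLpNorm_sub_le ((hmem n).sub (hmem M)).1 h3.1 hp).trans ((add_le_add
    ((eLpNorm_sub_le (hmem n).1 (hmem M).1 hp).trans (add_le_add
      (eLpNorm_sum_partialSum_le hm hA hp hp_top hgL n)
      (eLpNorm_sum_partialSum_le hm hA hp hp_top hgL M))) h4).trans ?_)
  rw [← mul_add, mul_comm, ← add_mul]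
  gcongr
  -- The constant is 9 = 4 + 4 + 1: two Fejér sums, of lengths `n` and `M ≤ n`, and the term `(n -
  -- M) g`.
  have h1 : 1 ≤ A := (by norm_num : 1 ≤ 2).trans ((hm 0).trans (hA 0))
  have h2 := Nat.mul_le_mul_left A h
  have h5 := Nat.mul_le_mul_right n h1
  exact_mod_cast (by linarith : 4 * A * n + 4 * A * M + n ≤ 9 * A * n)

/-- The block `M_N ≤ k < M_{N+1}` holds at least `M_{N+1}/2` indices, each contributing at least
`M_{N+1}^{-α}`. Thus the cost of one level is paid for by a block of `∑ (k+1)^{-α}`, uniformly in `α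
> 0`. -/
theorem rpow_genPow_succ_le (hm : ∀ k, 2 ≤ m k) {α : ℝ} (hα : 0 < α) (N : ℕ) :
    (genPow m (N + 1) : ℝ) ^ (1 - α) ≤
      2 * (∑ k ∈ Finset.range (genPow m (N + 1)), ((k : ℝ) + 1) ^ (-α) -
        ∑ k ∈ Finset.range (genPow m N), ((k : ℝ) + 1) ^ (-α)) := by
  set M := genPow m N
  set M' := genPow m (N + 1) with hM'
  have hpos : (0 : ℝ) < M' := by exact_mod_cast genPow_pos m (N + 1)
  have h2 : 2 * M ≤ M' := by rw [hM', genPow_succ]; exact Nat.mul_le_mul_right _ (hm N)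
  have h2' : (2 : ℝ) * M ≤ M' := by exact_mod_cast h2
  rw [← Finset.sum_Ico_eq_sub _ (by omega : M ≤ M')]
  have hle : ∑ k ∈ Finset.Ico M M', (M' : ℝ) ^ (-α) ≤
      ∑ k ∈ Finset.Ico M M', ((k : ℝ) + 1) ^ (-α) := by
    refine Finset.sum_le_sum fun k hk => ?_
    refine Real.rpow_le_rpow_of_nonpos (by positivity) ?_ (by linarith)
    exact_mod_cast (Finset.mem_Ico.1 hk).2
  rw [Finset.sum_const, Nat.card_Ico, nsmul_eq_mul, Nat.cast_sub (by omega)] at hle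
  have h3 : (M' : ℝ) ^ (1 - α) = M' * (M' : ℝ) ^ (-α) := by
    rw [sub_eq_add_neg, Real.rpow_add hpos, Real.rpow_one]
  rw [h3]
  have h4 := Real.rpow_pos_of_pos hpos (-α)
  have h5 := mul_le_mul_of_nonneg_right (by linarith : (M' : ℝ) ≤ 2 * (M' - M)) h4.le
  linarith

theorem exists_eLpNorm_sum_partialSum_sub_le (hm : ∀ k, 2 ≤ m k)
    (hbdd : BddAbove (Set.range m)) {p : ℝ≥0∞} (hp : 1 ≤ p) (hp_top : p ≠ ∞) {α : ℝ}
    (hα : 0 < α) {f : VilenkinGroup m → ℂ} (hf : MemLip m α p f) :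
    ∃ C : ℝ, 0 ≤ C ∧ ∀ n,
      eLpNorm (fun x => ∑ k ∈ Finset.range n, (partialSum m k f x - f x)) p (haar m) ≤
        ENNReal.ofReal (C * ∑ k ∈ Finset.range n, ((k : ℝ) + 1) ^ (-α)) := by
  obtain ⟨A, hA⟩ := hbdd
  have hA : ∀ k, m k ≤ A := fun k => hA ⟨k, rfl⟩
  obtain ⟨c, hc0, hc⟩ := exists_eLpNorm_partialSum_genPow_sub_le hm hp hp_top hf
  have hfp := hf.1
  set E : ℕ → ℝ≥0∞ := fun n =>
    eLpNorm (fun x => ∑ k ∈ Finset.range n, (partialSum m k f x - f x)) p (haar m) with hE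
  set a : ℕ → ℝ := fun n => ∑ k ∈ Finset.range n, ((k : ℝ) + 1) ^ (-α) with ha
  have hMpos : ∀ N, (0 : ℝ) < genPow m N := fun N => by exact_mod_cast genPow_pos m N
  have ha_mono : Monotone a := fun i j hij =>
    Finset.sum_le_sum_of_subset_of_nonneg (Finset.range_mono hij) fun k _ _ => by positivity
  set c' : ℝ := 9 * A * A * c with hc'
  have hc'0 : 0 ≤ c' := by positivity
  have hMα : ∀ N, 0 ≤ c' * (genPow m N : ℝ) ^ (1 - α) := fun N => by
    have := Real.rpow_nonneg (hMpos N).le (1 - α)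
    positivity
  have hstep : ∀ N n, genPow m N ≤ n → n ≤ genPow m (N + 1) →
      E n ≤ E (genPow m N) + ENNReal.ofReal (c' * (genPow m N : ℝ) ^ (1 - α)) := by
    intro N n h1 h2
    refine (eLpNorm_sum_partialSum_sub_le_add hm hA hp hp_top hfp h1).trans ?_
    gcongr
    have hn : 9 * A * n ≤ 9 * A * (A * genPow m N) :=
      Nat.mul_le_mul_left _ (h2.trans (Nat.mul_le_mul_right _ (hA N)))
    calc _ ≤ ((9 * A * (A * genPow m N) : ℕ) : ℝ≥0∞) *
          ENNReal.ofReal (c * (genPow m N : ℝ) ^ (-α)) := by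
          gcongr
          exact hc N
      _ = _ := by
        rw [← ENNReal.ofReal_natCast, ← ENNReal.ofReal_mul (by positivity)]
        congr 1
        rw [sub_eq_add_neg, Real.rpow_add (hMpos N), Real.rpow_one, hc']
        push_cast
        ring
  obtain ⟨F, hF0, hE1⟩ : ∃ F, 0 ≤ F ∧ E 1 = ENNReal.ofReal F :=
    ⟨(E 1).toReal, ENNReal.toReal_nonneg,
      (ENNReal.ofReal_toReal (memLp_sum_partialSum_sub hfp 1).eLpNorm_ne_top).symm⟩
  -- `F` covers the starting value `E 1`; `2 * c'` matches the factor 2 in `rpow_genPow_succ_le`.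
  set C := F + 2 * c' with hC
  -- The induction carries the increment `c' M_N^{1-α}` along, so that with `hstep` it covers every
  -- `n` of the block from `M_N` to `M_{N+1}`.
  have hind : ∀ N, E (genPow m N) + ENNReal.ofReal (c' * (genPow m N : ℝ) ^ (1 - α)) ≤
      ENNReal.ofReal (C * a (genPow m N)) := by
    intro N
    induction N with
    | zero =>
      simp only [genPow, hE1, Nat.cast_one, Real.one_rpow, mul_one]
      rw [← ENNReal.ofReal_add hF0 hc'0]
      apply ENNReal.ofReal_le_ofReal
      simp [ha]
      linarith
    | succ N ih =>
      have h1 := (hstep N (genPow m (N + 1)) (genPow_mono (Nat.le_succ N)) le_rfl).trans ih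
      have h2 := rpow_genPow_succ_le hm hα N
      have h3 : a (genPow m N) ≤ a (genPow m (N + 1)) := ha_mono (genPow_mono (Nat.le_succ N))
      have h4 : 0 ≤ a (genPow m N) := Finset.sum_nonneg fun k _ => by positivity
      refine (add_le_add_left h1 _).trans ?_
      rw [← ENNReal.ofReal_add (by positivity) (hMα _)]
      apply ENNReal.ofReal_le_ofReal
      have h5 := mul_le_mul_of_nonneg_left h2 hc'0
      have h6 := mul_nonneg hF0 (sub_nonneg.2 h3)
      rw [hC]
      simp only [ha] at h6 ⊢
      linarith
  refine ⟨C, by positivity, fun n => ?_⟩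
  rcases Nat.eq_zero_or_pos n with rfl | hn
  · simp
  · obtain ⟨N, h1, h2⟩ := exists_genPow_le_lt hm hn
    refine ((hstep N n h1 h2.le).trans (hind N)).trans (ENNReal.ofReal_le_ofReal ?_)
    exact mul_le_mul_of_nonneg_left (ha_mono h1) (by positivity)

end FejerError

/-! ### From summed errors to the `T` means -/

section Means

theorem weightSum_pos {q : ℕ → ℝ} (hq : ∀ k, 0 < q k) {n : ℕ} (hn : 0 < n) : 0 < weightSum q n :=
  Finset.sum_pos (fun k _ => hq k) (by simpa using hn.ne')

theorem exists_tError_le (hm : ∀ k, 2 ≤ m k) (hbdd : BddAbove (Set.range m)) {p : ℝ≥0∞}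
    (hp : 1 ≤ p) (hp_top : p ≠ ∞) {α : ℝ} (hα : 0 < α) {f : VilenkinGroup m → ℂ}
    (hf : MemLip m α p f) {q : ℕ → ℝ} (hq : Antitone q) (hq0 : ∀ k, 0 < q k) :
    ∃ C : ℝ, 0 ≤ C ∧ ∀ n, 0 < n → tError m q p f n ≤
      C * (∑ k ∈ Finset.range n, q k * ((k : ℝ) + 1) ^ (-α)) / weightSum q n := by
  obtain ⟨C, hC0, hC⟩ := exists_eLpNorm_sum_partialSum_sub_le hm hbdd hp hp_top hα hf
  refine ⟨C, hC0, fun n hn => ?_⟩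
  have hQ := weightSum_pos hq0 hn
  set b : ℕ → VilenkinGroup m → ℂ := fun k x => partialSum m k f x - f x with hb
  have h1 : (fun x => tMean m q n f x - f x) =
      (1 / weightSum q n) • ∑ k ∈ Finset.range n, q k • b k := by
    ext x
    have hQ' : (weightSum q n : ℂ) ≠ 0 := by exact_mod_cast hQ.ne'
    simp only [tMean, Pi.smul_apply, Finset.sum_apply, hb, Complex.real_smul, mul_sub,
      Finset.sum_sub_distrib, ← Finset.sum_mul]
    rw [← Complex.ofReal_sum]
    change _ = _ - _ * ((weightSum q n : ℂ) * f x)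
    push_cast
    field_simp
  have h2 := eLpNorm_sum_smul_le_of_antitone hp hq (fun k => (hq0 k).le)
    (fun k => (by positivity : 0 ≤ ((k : ℝ) + 1) ^ (-α))) hC0 (b := b)
    (fun k => ((memLp_partialSum k f p).sub hf.1).1) (fun n => by
      convert hC n using 2
      ext x
      simp [hb]) n
  have hV : 0 ≤ ∑ k ∈ Finset.range n, q k * ((k : ℝ) + 1) ^ (-α) :=
    Finset.sum_nonneg fun k _ => mul_nonneg (hq0 k).le (by positivity)
  refine ENNReal.toReal_le_of_le_ofReal (by positivity) ?_
  rw [h1, eLpNorm_const_smul, Real.enorm_of_nonneg (by positivity)]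
  refine (mul_le_mul_right h2 _).trans (le_of_eq ?_)
  rw [← ENNReal.ofReal_mul (by positivity)]
  congr 1
  ring

end Means

end Vilenkin

/-! ### Sums of logarithmic and power weights -/

section RealEstimates

/-- Concavity of `x ^ θ` (tangent line at `t`), obtained from weighted AM-GM `s^θ t^(1-θ) ≤ θ s +
(1-θ) t`. It replaces integral comparison by telescoping. -/
theorem Real.mul_rpow_mul_sub_le_rpow_sub_rpow {s t θ : ℝ} (hs : 0 ≤ s) (ht : 0 < t)
    (hθ0 : 0 ≤ θ) (hθ1 : θ ≤ 1) : θ * t ^ (θ - 1) * (t - s) ≤ t ^ θ - s ^ θ := by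
  have h := Real.geom_mean_le_arith_mean2_weighted hθ0 (sub_nonneg.2 hθ1) hs ht.le (by ring)
  have h1 : t ^ (1 - θ) * t ^ (θ - 1) = 1 := by
    rw [← Real.rpow_add ht]; simp
  have h2 : t * t ^ (θ - 1) = t ^ θ := by
    rw [Real.rpow_sub_one ht.ne', mul_div_cancel₀ _ ht.ne']
  have h3 := mul_le_mul_of_nonneg_right h (Real.rpow_nonneg ht.le (θ - 1))
  rw [mul_assoc, h1, mul_one] at h3
  nlinarith

theorem Real.rpow_neg_le_two_rpow_mul {x y β : ℝ} (hx : 0 < x) (hy : 0 < y) (hβ : 0 ≤ β)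
    (h : x ≤ 2 * y) : y ^ (-β) ≤ 2 ^ β * x ^ (-β) := by
  have h1 := Real.rpow_le_rpow_of_nonpos hx h (neg_nonpos.2 hβ)
  rw [Real.mul_rpow two_pos.le hy.le] at h1
  have h2 := mul_le_mul_of_nonneg_left h1 (Real.rpow_nonneg two_pos.le β)
  rwa [← mul_assoc, ← Real.rpow_add two_pos, add_neg_cancel, Real.rpow_zero, one_mul] at h2

theorem Real.log_natCast_add_two_pos (k : ℕ) : 0 < Real.log ((k : ℝ) + 2) :=
  Real.log_pos (by linarith [(Nat.cast_nonneg k : (0 : ℝ) ≤ k)])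

theorem Real.log_natCast_add_two_le {n : ℕ} (hn : 2 ≤ n) :
    Real.log ((n : ℝ) + 2) ≤ 2 * Real.log n := by
  have hn' : (2 : ℝ) ≤ n := by exact_mod_cast hn
  rw [← Real.log_rpow (by linarith)]
  apply Real.log_le_log (by linarith)
  norm_cast
  nlinarith

theorem Real.log_natCast_add_three_le (k : ℕ) :
    Real.log ((k : ℝ) + 3) ≤ 2 * Real.log ((k : ℝ) + 2) := by
  have hk : (0 : ℝ) ≤ k := Nat.cast_nonneg k
  rw [← Real.log_rpow (by linarith)]
  apply Real.log_le_log (by linarith)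
  norm_cast
  nlinarith

theorem Real.one_div_le_log_natCast_add_three_sub (k : ℕ) :
    1 / ((k : ℝ) + 3) ≤ Real.log ((k : ℝ) + 3) - Real.log ((k : ℝ) + 2) := by
  have hk : (0 : ℝ) ≤ k := Nat.cast_nonneg k
  rw [← Real.log_div (by linarith) (by linarith)]
  refine le_trans (le_of_eq ?_) (Real.one_sub_inv_le_log_of_pos (by positivity))
  field_simp
  ring

theorem Finset.sum_range_le_of_le_sub {u G : ℕ → ℝ} {δ : ℝ} (h : ∀ k, u k ≤ δ * (G (k + 1) - G k))
    (n : ℕ) : ∑ k ∈ Finset.range n, u k ≤ δ * (G n - G 0) := by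
  rw [← Finset.sum_range_sub, Finset.mul_sum]
  exact Finset.sum_le_sum fun k _ => h k

theorem sum_range_rpow_neg_le {γ : ℝ} (hγ0 : 0 ≤ γ) (hγ1 : γ < 1) (n : ℕ) :
    ∑ k ∈ Finset.range n, ((k : ℝ) + 1) ^ (-γ) ≤ (1 - γ)⁻¹ * (n : ℝ) ^ (1 - γ) := by
  have h := Finset.sum_range_le_of_le_sub (u := fun k : ℕ => ((k : ℝ) + 1) ^ (-γ))
    (G := fun k : ℕ => (k : ℝ) ^ (1 - γ)) (δ := (1 - γ)⁻¹) (fun k => by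
      have h1 := Real.mul_rpow_mul_sub_le_rpow_sub_rpow (s := k) (t := (k : ℝ) + 1) (θ := 1 - γ)
        (by positivity) (by positivity) (by linarith) (by linarith)
      rw [← div_eq_inv_mul, le_div_iff₀ (by linarith)]
      push_cast
      rw [show 1 - γ - 1 = -γ by ring] at h1
      linarith) n
  rwa [Nat.cast_zero, Real.zero_rpow (by linarith), sub_zero] at h

/-- Bounds a term by an increment of `log`, with the weight moved to the right endpoint as the
tangent inequality requires. The 3 comes from `1/(k+1) ≤ 3/(k+3)`, the `2 ^ β` from `log(k+3) ≤ 2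
log(k+2)`. -/
theorem log_rpow_neg_div_le {β : ℝ} (hβ : 0 ≤ β) (k : ℕ) :
    Real.log ((k : ℝ) + 2) ^ (-β) * ((k : ℝ) + 1)⁻¹ ≤
      3 * 2 ^ β * (Real.log ((k : ℝ) + 3) ^ (-β) *
        (Real.log ((k : ℝ) + 3) - Real.log ((k : ℝ) + 2))) := by
  have hk : (0 : ℝ) ≤ k := Nat.cast_nonneg k
  have hL := Real.log_natCast_add_two_pos k
  have hL3 : 0 < Real.log ((k : ℝ) + 3) := Real.log_pos (by linarith)
  have h1 := Real.rpow_neg_le_two_rpow_mul hL3 hL hβ (Real.log_natCast_add_three_le k)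
  have h2 : ((k : ℝ) + 1)⁻¹ ≤ 3 * (Real.log ((k : ℝ) + 3) - Real.log ((k : ℝ) + 2)) := by
    refine le_trans ?_ (mul_le_mul_of_nonneg_left
      (Real.one_div_le_log_natCast_add_three_sub k) (by norm_num))
    rw [mul_one_div, ← one_div, div_le_div_iff₀ (by linarith) (by linarith)]
    linarith
  calc _ ≤ (2 ^ β * Real.log ((k : ℝ) + 3) ^ (-β)) *
        (3 * (Real.log ((k : ℝ) + 3) - Real.log ((k : ℝ) + 2))) := by gcongr
    _ = _ := by ring

theorem sum_range_log_rpow_neg_div_le {β : ℝ} (hβ0 : 0 ≤ β) (hβ1 : β < 1) (n : ℕ) :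
    ∑ k ∈ Finset.range n, Real.log ((k : ℝ) + 2) ^ (-β) * ((k : ℝ) + 1)⁻¹ ≤
      3 * 2 ^ β * (1 - β)⁻¹ * Real.log ((n : ℝ) + 2) ^ (1 - β) := by
  refine (Finset.sum_range_le_of_le_sub (G := fun k : ℕ => Real.log ((k : ℝ) + 2) ^ (1 - β))
    (δ := 3 * 2 ^ β * (1 - β)⁻¹) (fun k => ?_) n).trans ?_
  · refine (log_rpow_neg_div_le hβ0 k).trans ?_
    rw [mul_assoc (3 * 2 ^ β)]
    refine mul_le_mul_of_nonneg_left ?_ (by positivity)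
    rw [← div_eq_inv_mul, le_div_iff₀ (by linarith)]
    have h1 := Real.mul_rpow_mul_sub_le_rpow_sub_rpow (s := Real.log ((k : ℝ) + 2))
      (t := Real.log ((k : ℝ) + 3)) (θ := 1 - β) (Real.log_natCast_add_two_pos k).le
      (Real.log_pos (by linarith [(Nat.cast_nonneg k : (0 : ℝ) ≤ k)])) (by linarith) (by linarith)
    rw [show 1 - β - 1 = -β by ring] at h1
    push_cast
    rw [show (k : ℝ) + 1 + 2 = k + 3 by ring]
    linarith
  · have : 0 < (1 - β)⁻¹ := inv_pos.2 (by linarith)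
    gcongr
    exact sub_le_self _ (Real.rpow_nonneg (Real.log_natCast_add_two_pos 0).le _)

theorem sum_range_log_inv_div_le (n : ℕ) :
    ∑ k ∈ Finset.range n, Real.log ((k : ℝ) + 2) ^ (-1 : ℝ) * ((k : ℝ) + 1)⁻¹ ≤
      6 * (Real.log (Real.log ((n : ℝ) + 2)) - Real.log (Real.log 2)) := by
  have h := Finset.sum_range_le_of_le_sub
    (u := fun k : ℕ => Real.log ((k : ℝ) + 2) ^ (-1 : ℝ) * ((k : ℝ) + 1)⁻¹)
    (G := fun k : ℕ => Real.log (Real.log ((k : ℝ) + 2))) (δ := 6) (fun k => ?_) n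
  · simpa using h
  · refine (log_rpow_neg_div_le zero_le_one k).trans ?_
    have hL := Real.log_natCast_add_two_pos k
    have hL3 : 0 < Real.log ((k : ℝ) + 3) :=
      Real.log_pos (by linarith [(Nat.cast_nonneg k : (0 : ℝ) ≤ k)])
    push_cast
    rw [show (k : ℝ) + 1 + 2 = k + 3 by ring, Real.rpow_one, show (3 : ℝ) * 2 = 6 by norm_num]
    gcongr
    rw [← Real.log_div hL3.ne' hL.ne']
    refine le_trans (le_of_eq ?_) (Real.one_sub_inv_le_log_of_pos (by positivity))
    rw [Real.rpow_neg_one]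
    field_simp

/-- A Potter-type bound: the logarithm varies slowly, so exchanging `k` for `n` in its power costs
only an arbitrarily small power of `n/k`. -/
theorem exists_log_rpow_neg_le {β ε : ℝ} (hβ : 0 < β) (hε : 0 < ε) :
    ∃ K : ℝ, 0 ≤ K ∧ ∀ k n : ℕ, k ≤ n → Real.log ((k : ℝ) + 2) ^ (-β) ≤
      K * Real.log ((n : ℝ) + 2) ^ (-β) * (((n : ℝ) + 1) / ((k : ℝ) + 1)) ^ ε := by
  -- Chosen so that raising `R ^ δ` to the power `β` gives `R ^ ε`.
  set δ := ε / β with hδ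
  have hδ0 : 0 < δ := div_pos hε hβ
  have hlog2 : 0 < Real.log 2 := Real.log_pos one_lt_two
  set c := 1 + 1 / (δ * Real.log 2) with hc
  have hc0 : 0 < c := by positivity
  refine ⟨c ^ β, by positivity, fun k n hkn => ?_⟩
  have hk : (0 : ℝ) ≤ k := Nat.cast_nonneg k
  have hkn' : (k : ℝ) ≤ n := by exact_mod_cast hkn
  have hLk := Real.log_natCast_add_two_pos k
  have hLn := Real.log_natCast_add_two_pos n
  set R := ((n : ℝ) + 1) / ((k : ℝ) + 1) with hR
  have hR1 : 1 ≤ R := by rw [hR, le_div_iff₀ (by linarith)]; linarith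
  have hRδ : 1 ≤ R ^ δ := Real.one_le_rpow hR1 hδ0.le
  have h1 : Real.log ((n : ℝ) + 2) ≤ Real.log ((k : ℝ) + 2) + R ^ δ / δ := by
    have h2 : Real.log ((n : ℝ) + 2) - Real.log ((k : ℝ) + 2) ≤ Real.log R := by
      rw [← Real.log_div (by linarith) (by linarith)]
      apply Real.log_le_log (by positivity)
      rw [hR, div_le_div_iff₀ (by linarith) (by linarith)]
      nlinarith
    have h3 := Real.log_le_rpow_div (zero_le_one.trans hR1) hδ0
    linarith
  have h2 : Real.log ((n : ℝ) + 2) ≤ c * R ^ δ * Real.log ((k : ℝ) + 2) := by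
    have h3 : Real.log 2 ≤ Real.log ((k : ℝ) + 2) := Real.log_le_log two_pos (by linarith)
    have h4 : R ^ δ / δ ≤ 1 / (δ * Real.log 2) * R ^ δ * Real.log ((k : ℝ) + 2) := by
      calc R ^ δ / δ = 1 / (δ * Real.log 2) * R ^ δ * Real.log 2 := by field_simp
        _ ≤ _ := by gcongr
    have h5 : Real.log ((k : ℝ) + 2) ≤ R ^ δ * Real.log ((k : ℝ) + 2) :=
      le_mul_of_one_le_left hLk.le hRδ
    rw [hc]
    linarith
  have h3 := Real.rpow_le_rpow hLn.le h2 hβ.le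
  rw [Real.mul_rpow (by positivity) hLk.le, Real.mul_rpow hc0.le (by positivity),
    ← Real.rpow_mul (by linarith), hδ, div_mul_cancel₀ _ hβ.ne'] at h3
  have hkβ := Real.rpow_pos_of_pos hLk β
  have hnβ := Real.rpow_pos_of_pos hLn β
  rw [Real.rpow_neg hLk.le, Real.rpow_neg hLn.le, inv_le_iff_one_le_mul₀ hkβ,
    mul_right_comm (c ^ β), mul_assoc _ _ (Real.log ((k : ℝ) + 2) ^ β), ← div_eq_inv_mul,
    mul_div_assoc', le_div_iff₀ hnβ, one_mul]
  exact h3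

theorem exists_sum_range_log_rpow_neg_mul_rpow_neg_le {α β : ℝ} (hα0 : 0 < α) (hα1 : α < 1)
    (hβ : 0 < β) :
    ∃ K : ℝ, 0 ≤ K ∧ ∀ n : ℕ, 0 < n →
      ∑ k ∈ Finset.range n, Real.log ((k : ℝ) + 2) ^ (-β) * ((k : ℝ) + 1) ^ (-α) ≤
        K * (Real.log ((n : ℝ) + 2) ^ (-β) * (n : ℝ) ^ (1 - α)) := by
  -- Keeps `α + ε < 1`, so the power sum still has order `n^{1-(α+ε)}`.
  set ε := (1 - α) / 2 with hε
  have hε0 : 0 < ε := by rw [hε]; linarith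
  obtain ⟨K, hK0, hK⟩ := exists_log_rpow_neg_le hβ hε0
  refine ⟨K * (2 ^ ε * (1 - (α + ε))⁻¹), mul_nonneg hK0 (mul_nonneg (by positivity)
    (inv_nonneg.2 (by linarith))), fun n hn => ?_⟩
  have hn1 : (1 : ℝ) ≤ n := by exact_mod_cast hn
  have hn0 : (0 : ℝ) < n := by linarith
  have hL := Real.rpow_nonneg (Real.log_natCast_add_two_pos n).le (-β)
  calc _ ≤ ∑ k ∈ Finset.range n, K * Real.log ((n : ℝ) + 2) ^ (-β) * ((n : ℝ) + 1) ^ ε *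
        ((k : ℝ) + 1) ^ (-(α + ε)) := by
        refine Finset.sum_le_sum fun k hk => ?_
        have hk0 : (0 : ℝ) < k + 1 := by positivity
        refine (mul_le_mul_of_nonneg_right (hK k n (Finset.mem_range.1 hk).le)
          (Real.rpow_nonneg hk0.le _)).trans (le_of_eq ?_)
        rw [Real.div_rpow (by linarith) hk0.le, neg_add, Real.rpow_add hk0,
          Real.rpow_neg hk0.le ε]
        ring
    _ ≤ K * Real.log ((n : ℝ) + 2) ^ (-β) * (2 * n) ^ ε *
        ((1 - (α + ε))⁻¹ * (n : ℝ) ^ (1 - (α + ε))) := by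
        rw [← Finset.mul_sum]
        have := sum_range_rpow_neg_le (γ := α + ε) (by linarith) (by linarith) n
        gcongr
        linarith
    _ = _ := by
        rw [Real.mul_rpow two_pos.le hn0.le, show 1 - α = ε + (1 - (α + ε)) by ring,
          Real.rpow_add hn0]
        ring

end RealEstimates

namespace Vilenkin

/-! ### Weights comparable to powers of the logarithm -/

section Weights

variable {q : ℕ → ℝ} {β : ℝ}

/-- The shift by 2 makes the logarithm positive at every index, so asymptotic comparisons become
bounds for all `k`. -/
theorem isTheta_log_add_two (hβ : 0 < β) :
    (fun k : ℕ => Real.log k ^ (-β)) =Θ[atTop] fun k : ℕ => Real.log ((k : ℝ) + 2) ^ (-β) := by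
  constructor
  · refine IsBigO.of_bound (2 ^ β) ?_
    filter_upwards [eventually_ge_atTop 2] with k hk
    have hk' : (2 : ℝ) ≤ k := by exact_mod_cast hk
    have hL : 0 < Real.log k := Real.log_pos (by linarith)
    have hL2 := Real.log_natCast_add_two_pos k
    rw [Real.norm_of_nonneg (by positivity), Real.norm_of_nonneg (by positivity)]
    exact Real.rpow_neg_le_two_rpow_mul hL2 hL hβ.le (Real.log_natCast_add_two_le hk)
  · refine IsBigO.of_bound 1 ?_
    filter_upwards [eventually_ge_atTop 2] with k hk
    have hk' : (2 : ℝ) ≤ k := by exact_mod_cast hk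
    have hL : 0 < Real.log k := Real.log_pos (by linarith)
    have hL2 := Real.log_natCast_add_two_pos k
    rw [Real.norm_of_nonneg (by positivity), Real.norm_of_nonneg (by positivity), one_mul]
    exact Real.rpow_le_rpow_of_nonpos hL (Real.log_le_log (by linarith) (by linarith))
      (neg_nonpos.2 hβ.le)

/-- Comparability makes `q` nonzero at arbitrarily large indices, and monotonicity carries
positivity back to every `k`. -/
theorem pos_of_isTheta (hq0 : ∀ k, 0 ≤ q k) (hq_anti : Antitone q)
    (hq : q =Θ[atTop] fun k : ℕ => Real.log ((k : ℝ) + 2) ^ (-β)) (k : ℕ) : 0 < q k := by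
  obtain ⟨l, hl, hkl⟩ := (hq.eq_zero_iff.and (eventually_ge_atTop k)).exists
  refine lt_of_lt_of_le (lt_of_le_of_ne (hq0 l) fun h => ?_) (hq_anti hkl)
  exact (Real.rpow_pos_of_pos (Real.log_natCast_add_two_pos l) (-β)).ne' (hl.1 h.symm)

theorem exists_weight_le (hq0 : ∀ k, 0 ≤ q k)
    (hq : q =O[atTop] fun k : ℕ => Real.log ((k : ℝ) + 2) ^ (-β)) :
    ∃ C, 0 < C ∧ ∀ k : ℕ, q k ≤ C * Real.log ((k : ℝ) + 2) ^ (-β) := by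
  obtain ⟨C, hC0, hC⟩ := bound_of_isBigO_nat_atTop hq
  refine ⟨C, hC0, fun k => ?_⟩
  have h := Real.rpow_pos_of_pos (Real.log_natCast_add_two_pos k) (-β)
  simpa only [Real.norm_of_nonneg (hq0 k), Real.norm_of_nonneg h.le] using hC (x := k) h.ne'

theorem exists_le_weight (hq0 : ∀ k, 0 < q k)
    (hq : (fun k : ℕ => Real.log ((k : ℝ) + 2) ^ (-β)) =O[atTop] q) :
    ∃ C, 0 < C ∧ ∀ k : ℕ, Real.log ((k : ℝ) + 2) ^ (-β) ≤ C * q k := by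
  obtain ⟨C, hC0, hC⟩ := bound_of_isBigO_nat_atTop hq
  refine ⟨C, hC0, fun k => ?_⟩
  have h := Real.rpow_pos_of_pos (Real.log_natCast_add_two_pos k) (-β)
  simpa only [Real.norm_of_nonneg (hq0 k).le, Real.norm_of_nonneg h.le] using
    hC (x := k) (hq0 k).ne'

theorem natCast_mul_le_weightSum (hq_anti : Antitone q) (n : ℕ) : n * q n ≤ weightSum q n := by
  have := Finset.card_nsmul_le_sum (Finset.range n) q (q n)
    fun k hk => hq_anti (Finset.mem_range.1 hk).le
  simpa [weightSum] using this

/-- The error is controlled by `L_n ^ β n⁻¹ V_n`, where `L_n = log (n + 2)` and `V_n` is any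
upper bound for `∑_{k < n} L_k ^ (-β) (k + 1) ^ (-α)`. -/
theorem exists_tError_le_of_isTheta {m : ℕ → ℕ} [∀ k, NeZero (m k)] (hm : ∀ k, 2 ≤ m k)
    (hbdd : BddAbove (Set.range m)) (hq_nonneg : ∀ k, 0 ≤ q k) (hq_anti : Antitone q)
    (hβ : 0 < β) (hq : q =Θ[atTop] fun k : ℕ => Real.log k ^ (-β)) {α : ℝ} (hα : 0 < α)
    {p : ℝ≥0∞} (hp : 1 ≤ p) (hp_top : p ≠ ∞) {f : VilenkinGroup m → ℂ} (hf : MemLip m α p f) :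
    ∃ C : ℝ, 0 ≤ C ∧ ∀ n : ℕ, 0 < n → ‖tError m q p f n‖ ≤
      C * ((∑ k ∈ Finset.range n, Real.log ((k : ℝ) + 2) ^ (-β) * ((k : ℝ) + 1) ^ (-α)) *
        ((n : ℝ)⁻¹ * Real.log ((n : ℝ) + 2) ^ β)) := by
  have hq' := hq.trans (isTheta_log_add_two hβ)
  have hq0 := pos_of_isTheta hq_nonneg hq_anti hq'
  obtain ⟨C, hC0, hC⟩ := exists_tError_le hm hbdd hp hp_top hα hf hq_anti hq0
  obtain ⟨D, hD0, hD⟩ := exists_weight_le hq_nonneg hq'.1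
  obtain ⟨D', hD'0, hD'⟩ := exists_le_weight hq0 hq'.2
  refine ⟨C * D * D', by positivity, fun n hn => ?_⟩
  have hn0 : (0 : ℝ) < n := by exact_mod_cast hn
  have hL := Real.log_natCast_add_two_pos n
  have hQ := weightSum_pos hq0 hn
  rw [tError, Real.norm_of_nonneg ENNReal.toReal_nonneg]
  refine (hC n hn).trans ?_
  rw [div_eq_mul_inv]
  have h1 : (weightSum q n)⁻¹ ≤ D' * ((n : ℝ)⁻¹ * Real.log ((n : ℝ) + 2) ^ β) := by
    have h2 := natCast_mul_le_weightSum hq_anti n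
    have h3 := hD' n
    rw [Real.rpow_neg hL.le] at h3
    have hLβ := Real.rpow_pos_of_pos hL β
    rw [inv_le_iff_one_le_mul₀ hQ]
    rw [inv_le_iff_one_le_mul₀ hLβ] at h3
    calc (1 : ℝ) ≤ D' * q n * Real.log ((n : ℝ) + 2) ^ β := h3
      _ = D' * ((n : ℝ)⁻¹ * Real.log ((n : ℝ) + 2) ^ β) * (n * q n) := by field_simp
      _ ≤ _ := by gcongr
  have h4 : ∑ k ∈ Finset.range n, q k * ((k : ℝ) + 1) ^ (-α) ≤
      D * ∑ k ∈ Finset.range n, Real.log ((k : ℝ) + 2) ^ (-β) * ((k : ℝ) + 1) ^ (-α) := by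
    rw [Finset.mul_sum]
    refine Finset.sum_le_sum fun k _ => ?_
    rw [← mul_assoc]
    exact mul_le_mul_of_nonneg_right (hD k) (by positivity)
  have h5 : 0 ≤ ∑ k ∈ Finset.range n, q k * ((k : ℝ) + 1) ^ (-α) :=
    Finset.sum_nonneg fun k _ => mul_nonneg (hq_nonneg k) (by positivity)
  calc _ ≤ C * (D * ∑ k ∈ Finset.range n,
        Real.log ((k : ℝ) + 2) ^ (-β) * ((k : ℝ) + 1) ^ (-α)) *
        (D' * ((n : ℝ)⁻¹ * Real.log ((n : ℝ) + 2) ^ β)) := by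
        refine mul_le_mul (mul_le_mul_of_nonneg_left h4 hC0) h1 (inv_nonneg.2 hQ.le)
          (mul_nonneg hC0 (h5.trans h4))
    _ = _ := by ring

end Weights

end Vilenkin

theorem corollary3 (m : ℕ → ℕ) [∀ k, NeZero (m k)] (hm : ∀ k, 2 ≤ m k)
    (hbdd : BddAbove (Set.range m))
    (q : ℕ → ℝ) (hq_nonneg : ∀ k, 0 ≤ q k) (hq_anti : Antitone q)
    (β : ℝ) (hβ : 0 < β)
    (hq : q =Θ[atTop] fun k : ℕ => Real.log k ^ (-β))
    (α : ℝ) (hα : 0 < α) (p : ℝ≥0∞) (hp : 1 ≤ p) (hp_top : p < ∞)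
    (f : Vilenkin.VilenkinGroup m → ℂ) (hf : Vilenkin.MemLip m α p f) :
    (α < 1 →
      Vilenkin.tError m q p f =O[atTop] fun n : ℕ => (n : ℝ) ^ (-α)) ∧
    (α = 1 → β < 1 →
      Vilenkin.tError m q p f =O[atTop] fun n : ℕ => (n : ℝ)⁻¹ * Real.log n) ∧
    (α = 1 → β = 1 →
      Vilenkin.tError m q p f =O[atTop]
        fun n : ℕ => (n : ℝ)⁻¹ * Real.log n * Real.log (Real.log n)) ∧
    (1 < α →
      Vilenkin.tError m q p f =O[atTop] fun n : ℕ => (n : ℝ)⁻¹ * Real.log n ^ β) := by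
  obtain ⟨C, hC0, hC⟩ := Vilenkin.exists_tError_le_of_isTheta hm hbdd hq_nonneg hq_anti hβ hq hα
    hp hp_top.ne hf
  refine ⟨fun hα1 => ?_, ?_, ?_, fun hα1 => ?_⟩
  · obtain ⟨K, hK0, hK⟩ := exists_sum_range_log_rpow_neg_mul_rpow_neg_le hα hα1 hβ
    refine IsBigO.of_bound (C * K) ?_
    filter_upwards [eventually_gt_atTop 0] with n hn
    have hn0 : (0 : ℝ) < n := by exact_mod_cast hn
    have hL := Real.log_natCast_add_two_pos n
    refine (hC n hn).trans ?_
    rw [Real.norm_of_nonneg (by positivity), mul_assoc C]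
    refine mul_le_mul_of_nonneg_left ?_ hC0
    refine (mul_le_mul_of_nonneg_right (hK n hn) (by positivity)).trans (le_of_eq ?_)
    -- The factors `log(n+2)^{-β}` and `log(n+2)^β` cancel, so no logarithm survives for `α < 1`.
    rw [Real.rpow_neg hL.le, sub_eq_add_neg, Real.rpow_add hn0, Real.rpow_one]
    have := Real.rpow_pos_of_pos hL β
    field_simp
  · rintro rfl hβ1
    refine IsBigO.of_bound (C * (3 * 2 ^ β * (1 - β)⁻¹) * 2) ?_
    filter_upwards [eventually_ge_atTop 2] with n hn
    have hn2 : (2 : ℝ) ≤ n := by exact_mod_cast hn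
    have hL := Real.log_natCast_add_two_pos n
    have hlog : 0 < Real.log n := Real.log_pos (by linarith)
    refine (hC n (by omega)).trans ?_
    rw [Real.norm_of_nonneg (by positivity), mul_assoc, mul_assoc]
    refine mul_le_mul_of_nonneg_left ?_ hC0
    simp_rw [Real.rpow_neg_one]
    refine (mul_le_mul_of_nonneg_right (sum_range_log_rpow_neg_div_le hβ.le hβ1 n)
      (by positivity)).trans ?_
    have h1 : Real.log ((n : ℝ) + 2) ^ (1 - β) * Real.log ((n : ℝ) + 2) ^ β =
        Real.log ((n : ℝ) + 2) := by
      rw [← Real.rpow_add hL, sub_add_cancel, Real.rpow_one]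
    have h2 := Real.log_natCast_add_two_le hn
    have h3 : 0 < (1 - β)⁻¹ := inv_pos.2 (by linarith)
    calc _ = 3 * 2 ^ β * (1 - β)⁻¹ * ((n : ℝ)⁻¹ * (Real.log ((n : ℝ) + 2) ^ (1 - β) *
          Real.log ((n : ℝ) + 2) ^ β)) := by ring
      _ ≤ 3 * 2 ^ β * (1 - β)⁻¹ * ((n : ℝ)⁻¹ * (2 * Real.log n)) := by
          rw [h1]; gcongr
      _ = _ := by ring
  · rintro rfl rfl
    -- From `log(n+2) ≤ 2 log n`, the double logarithm exceeds `log log n` by at most `log 2`;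
    -- together with `-log log 2` this is `c`, absorbed once `log log n ≥ 1`.
    set c := Real.log 2 - Real.log (Real.log 2) with hc
    refine IsBigO.of_bound (C * (6 * (1 + |c|)) * 2) ?_
    have hlim : Tendsto (fun n : ℕ => Real.log (Real.log n)) atTop atTop :=
      Real.tendsto_log_atTop.comp (Real.tendsto_log_atTop.comp tendsto_natCast_atTop_atTop)
    filter_upwards [eventually_ge_atTop 2, hlim.eventually_ge_atTop 1] with n hn hll
    have hn2 : (2 : ℝ) ≤ n := by exact_mod_cast hn
    have hL := Real.log_natCast_add_two_pos n
    have hlog : 0 < Real.log n := Real.log_pos (by linarith)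
    refine (hC n (by omega)).trans ?_
    rw [Real.norm_of_nonneg (by positivity), mul_assoc, mul_assoc]
    refine mul_le_mul_of_nonneg_left ?_ hC0
    have h2 := Real.log_natCast_add_two_le hn
    have h1 : Real.log (Real.log ((n : ℝ) + 2)) - Real.log (Real.log 2) ≤
        (1 + |c|) * Real.log (Real.log n) := by
      have h3 := Real.log_le_log hL h2
      rw [Real.log_mul two_ne_zero hlog.ne'] at h3
      have h4 : c ≤ |c| * Real.log (Real.log n) :=
        (le_abs_self c).trans (le_mul_of_one_le_right (abs_nonneg c) hll)
      rw [hc] at h4 ⊢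
      linarith
    have h5 := (sum_range_log_inv_div_le n).trans (mul_le_mul_of_nonneg_left h1 (by norm_num))
    rw [Real.rpow_one]
    calc _ ≤ 6 * ((1 + |c|) * Real.log (Real.log n)) * ((n : ℝ)⁻¹ * (2 * Real.log n)) := by
          simp_rw [Real.rpow_neg_one] at h5 ⊢
          gcongr
      _ = _ := by ring
  · have hsum : Summable fun k : ℕ => ((k : ℝ) + 1) ^ (-α) := by
      have := (summable_nat_add_iff 1).2 (Real.summable_nat_rpow.2 (by linarith : -α < -1))
      simpa using this
    set S := ∑' k : ℕ, ((k : ℝ) + 1) ^ (-α) with hS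
    have hS0 : 0 ≤ S := tsum_nonneg fun k => by positivity
    have hlog2 : 0 < Real.log 2 := Real.log_pos one_lt_two
    refine IsBigO.of_bound (C * (Real.log 2 ^ (-β) * S * 2 ^ β)) ?_
    filter_upwards [eventually_ge_atTop 2] with n hn
    have hn2 : (2 : ℝ) ≤ n := by exact_mod_cast hn
    have hL := Real.log_natCast_add_two_pos n
    have hlog : 0 < Real.log n := Real.log_pos (by linarith)
    refine (hC n (by omega)).trans ?_
    rw [Real.norm_of_nonneg (by positivity), mul_assoc]
    refine mul_le_mul_of_nonneg_left ?_ hC0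
    have h1 : ∑ k ∈ Finset.range n, Real.log ((k : ℝ) + 2) ^ (-β) * ((k : ℝ) + 1) ^ (-α) ≤
        Real.log 2 ^ (-β) * S := by
      refine le_trans ?_ (mul_le_mul_of_nonneg_left
        (hsum.sum_le_tsum (Finset.range n) fun k _ => by positivity) (by positivity))
      rw [Finset.mul_sum]
      refine Finset.sum_le_sum fun k _ => mul_le_mul_of_nonneg_right ?_ (by positivity)
      exact Real.rpow_le_rpow_of_nonpos hlog2
        (Real.log_le_log two_pos (by linarith [(Nat.cast_nonneg k : (0 : ℝ) ≤ k)]))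
        (neg_nonpos.2 hβ.le)
    have h2 := Real.rpow_le_rpow hL.le (Real.log_natCast_add_two_le hn) hβ.le
    rw [Real.mul_rpow two_pos.le hlog.le] at h2
    calc _ ≤ Real.log 2 ^ (-β) * S * ((n : ℝ)⁻¹ * (2 ^ β * Real.log n ^ β)) := by gcongr
      _ = _ := by ring
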